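/- Let $A$ be a (finite-dimensional, associative, unital) semisimple algebra over $\mathbb C$ with a given basis $a_1,\dots,a_n$, and let $d\ge 2$ be even. For a hypermatrix $X=(X_{i_1,\dots,i_d})_{i_k\in[n]}$ put $$\mathrm{det}_d(X)=\frac1{n!}\sum_{\sigma_1,\dots,\sigma_d\in S_n}\mathrm{sgn}(\sigma_1)\cdots\mathrm{sgn}(\sigma_d)\prod_{i=1}^nX_{\sigma_1(i),\dots,\sigma_d(i)} .$$ Let $\ell_x=\sum_k x_ka_k^*$ be the generic linear form on $A$, with $(a_k^*)$ the dual basis and $x_1,\dots,x_n$ formal variables, and let $C^A(x)_{i_1,\dots,i_d}=\ell_x(a_{i_1}\cdots a_{i_d})\in\mathbb C[x_1,\dots,x_n]$. Let $\widehat A$ be a set of representatives $\rho:A\to\mathrm{End}(V_\rho)$ of the isomorphism classes of irreducible representations of $A$, and put $n_\rho=\dim V_\rho$. Then $\Phi=\bigoplus_\rho\rho:A\to\bigoplus_{\rho\in\widehat A}\mathrm{End}(V_\rho)$ is an algebra isomorphism, $n=\sum_\rho n_\rho^2$, and the following holds. Let $(E^\rho_{ij})_{i,j\in[n_\rho]}$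 be any basis of matrix units of $\mathrm{End}(V_\rho)$ (that is, $E^\rho_{ij}E^\rho_{kl}=\delta_{jk}E^\rho_{il}$), let $\det(\Phi)$ be the determinant of $\Phi$ in the bases $(a_k)$ and $(E^\rho_{ij})$, the latter in any order, let $y^\rho=(y^\rho_{ij})$ with $y^\rho_{ij}=\ell_x(\Phi^{-1}(E^\rho_{ij}))$, and let $h_{k\times k}=\prod_{i=0}^{k-1}\frac{(k+i)!}{i!}$. Then, as polynomials in $x$, $$\mathrm{det}_d(C^A(x))=H_A\prod_{\rho\in\widehat A}\det(y^\rho)^{n_\rho},\qquad H_A=(-1)^{\frac d2\sum_\rho\binom{n_\rho}{2}}\det(\Phi)^d\Big(\prod_{\rho\in\widehat A}h_{n_\rho\times n_\rho}\Big)^{d/2-1}\neq0 .$$ Equivalently, in the Fourier normalization, where $\det(\widetilde\Phi)$ is the determinant of the same matrix of $\Phi$ after every row $(\rho,i,j)$ has been multiplied by $(n_\rho/n)^{1/2}$, and $\widetilde y^\rho=\frac n{n_\rho}y^\rho$, $$\mathrm{det}_d(C^A(x))=\widetilde H_A\prod_{\rho\in\widehat A}\det(\widetilde y^\rho)^{n_\rho},\qquad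 \widetilde H_A=(-1)^{\frac d2\sum_\rho\binom{n_\rho}{2}}\det(\widetilde\Phi)^d\Big(n^n\prod_{\rho\in\widehat A}\frac{h_{n_\rho\times n_\rho}}{n_\rho^{\,n_\rho^2}}\Big)^{d/2-1}\neq0 .$$ The polynomials $\det(y^\rho)$ do not depend on the choice of the matrix units in $\mathrm{End}(V_\rho)$. -/

import Mathlib

universe u v w

noncomputable section

/-- Cayley's combinatorial hyperdeterminant of a `d`-way hypermatrix of side `n`:
`det_d X = (1 / n!) ∑_{σ₁,…,σ_d ∈ S_n} sgn σ₁ ⋯ sgn σ_d ∏_i X_{σ₁(i),…,σ_d(i)}`. -/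
def hyperdet {R : Type u} [CommRing R] [Algebra ℂ R] {n : ℕ} (d : ℕ)
    (X : (Fin d → Fin n) → R) : R :=
  ((n.factorial : ℂ)⁻¹) •
    ∑ σ : Fin d → Equiv.Perm (Fin n),
      (∏ k, (((Equiv.Perm.sign (σ k) : ℤˣ) : ℤ) : R)) * ∏ i, X (fun k => σ k i)

/-- The generic linear form `ℓ_x = ∑ k, x_k a_k^*` on an algebra with basis `a`, with values in
the polynomial ring in the variables `x_k`. -/
def genericForm {A : Type u} [Ring A] [Algebra ℂ A] {n : ℕ} (a : Module.Basis (Fin n) ℂ A)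
    (b : A) : MvPolynomial (Fin n) ℂ :=
  ∑ k, MvPolynomial.C (a.repr b k) * MvPolynomial.X k

/-- The algebra hypermatrix `C^A(x)_{i_1,…,i_d} = ℓ_x (a_{i_1} ⋯ a_{i_d})`. -/
def algebraHypermatrix {A : Type u} [Ring A] [Algebra ℂ A] {n : ℕ}
    (a : Module.Basis (Fin n) ℂ A) (d : ℕ) (i : Fin d → Fin n) : MvPolynomial (Fin n) ℂ :=
  genericForm a (List.ofFn (fun k => a (i k))).prod

/-- `V` is a set of representatives of the isomorphism classes of simple `A`-modules. (Every simple
`A`-module is a quotient of `A`, so it is enough to test modules in the universe of `A`.) -/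
structure IsCompleteSetOfSimples (A : Type u) [Ring A] {ι : Type w} (V : ι → Type v)
    [∀ ρ, AddCommGroup (V ρ)] [∀ ρ, Module A (V ρ)] : Prop where
  simple : ∀ ρ, IsSimpleModule A (V ρ)
  inequivalent : ∀ ρ σ, Nonempty (V ρ ≃ₗ[A] V σ) → ρ = σ
  complete : ∀ (M : Type u) [AddCommGroup M] [Module A M], IsSimpleModule A M →
    ∃ ρ, Nonempty (M ≃ₗ[A] V ρ)

section Wedderburn

variable (A : Type u) [Ring A] [Algebra ℂ A] {ι : Type w} (V : ι → Type v)
  [∀ ρ, AddCommGroup (V ρ)] [∀ ρ, Module ℂ (V ρ)] [∀ ρ, Module A (V ρ)]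
  [∀ ρ, IsScalarTower ℂ A (V ρ)]

/-- The map `Φ = ⊕ ρ : A → ⊕ End(V_ρ)`, whose component `ρ` is the action of `A` on `V_ρ`. -/
def wedderburnHom : A →ₐ[ℂ] ∀ ρ, Module.End ℂ (V ρ) :=
  AlgHom.pi fun ρ => Algebra.lsmul ℂ ℂ (V ρ)

/-- `Φ` as an algebra isomorphism, once it is known to be bijective. -/
def wedderburnEquiv (hΦ : Function.Bijective (wedderburnHom A V)) :
    A ≃ₐ[ℂ] ∀ ρ, Module.End ℂ (V ρ) :=
  AlgEquiv.ofBijective (wedderburnHom A V) hΦ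

/-- Index set `{(ρ, i, j) : i, j ∈ [n_ρ]}` of the matrix units of `⊕ End(V_ρ)`. -/
abbrev UnitIndex : Type w :=
  Σ ρ, Fin (Module.finrank ℂ (V ρ)) × Fin (Module.finrank ℂ (V ρ))

end Wedderburn

/-- A basis `E_{ij}` of `End(V)` is a basis of matrix units: `E_{ij} E_{kl} = δ_{jk} E_{il}`. -/
def IsMatrixUnits {V : Type v} [AddCommGroup V] [Module ℂ V] {m : ℕ}
    (E : Module.Basis (Fin m × Fin m) ℂ (Module.End ℂ V)) : Prop :=
  ∀ i j k l, E (i, j) * E (k, l) = if j = k then E (i, l) else 0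

/-- `h_{m × m} = ∏_{i < m} (m + i)! / i!`, the product of the hooks of the `m × m` square. -/
def hookProduct (m : ℕ) : ℂ :=
  ∏ i ∈ Finset.range m, ((m + i).factorial : ℂ) / (i.factorial : ℂ)

section Coordinates

variable {A : Type u} [Ring A] [Algebra ℂ A] {n : ℕ} (a : Module.Basis (Fin n) ℂ A)
  {ι : Type w} [Fintype ι] [DecidableEq ι] {V : ι → Type v}
  [∀ ρ, AddCommGroup (V ρ)] [∀ ρ, Module ℂ (V ρ)]
  (Φ : A ≃ₐ[ℂ] ∀ ρ, Module.End ℂ (V ρ))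
  (E : ∀ ρ, Module.Basis
    (Fin (Module.finrank ℂ (V ρ)) × Fin (Module.finrank ℂ (V ρ))) ℂ (Module.End ℂ (V ρ)))

/-- The matrix of `Φ` in the basis `a` of `A` and the basis `E` of `⊕ End(V_ρ)`: row `(ρ, i, j)`,
column `k` holds the coefficient of `E^ρ_{ij}` in `Φ(a_k)`. -/
def wedderburnMatrix : Matrix (UnitIndex V) (Fin n) ℂ :=
  LinearMap.toMatrix a (Pi.basis E) Φ.toLinearMap

/-- The matrix `y^ρ = (y^ρ_{ij})` of Wedderburn coordinates `y^ρ_{ij} = ℓ_x (Φ⁻¹ E^ρ_{ij})`. -/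
def wedderburnCoord (ρ : ι) :
    Matrix (Fin (Module.finrank ℂ (V ρ))) (Fin (Module.finrank ℂ (V ρ)))
      (MvPolynomial (Fin n) ℂ) :=
  Matrix.of fun i j => genericForm a (Φ.symm (Pi.single ρ (E ρ (i, j))))

/-- The determinant of `Φ` in the basis `a` of `A` and the matrix units `E`, listed in the order
given by `e`. -/
def wedderburnDet (e : UnitIndex V ≃ Fin n) : ℂ :=
  ((wedderburnMatrix a Φ E).submatrix e.symm id).det

/-- The determinant of `Φ` after Fourier normalization: the row `(ρ, i, j)` of its matrix is
multiplied by `(n_ρ / n)^{1/2}`. -/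
def normalizedWedderburnDet (e : UnitIndex V ≃ Fin n) : ℂ :=
  ((Matrix.of fun (p : UnitIndex V) (k : Fin n) =>
    ((Real.sqrt ((Module.finrank ℂ (V p.1) : ℝ) / (n : ℝ)) : ℝ) : ℂ) *
      wedderburnMatrix a Φ E p k).submatrix e.symm id).det

/-- The Wedderburn coordinates after Fourier normalization, `(n / n_ρ) y^ρ`. -/
def normalizedWedderburnCoord (ρ : ι) :
    Matrix (Fin (Module.finrank ℂ (V ρ))) (Fin (Module.finrank ℂ (V ρ)))
      (MvPolynomial (Fin n) ℂ) :=
  ((n : ℂ) / (Module.finrank ℂ (V ρ) : ℂ)) • wedderburnCoord a Φ E ρ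

/-- The sign `(-1)^{(d/2) ∑_ρ n_ρ (n_ρ - 1) / 2}`. -/
def transposeSign (V : ι → Type v) [∀ ρ, AddCommGroup (V ρ)] [∀ ρ, Module ℂ (V ρ)] (d : ℕ) : ℂ :=
  (-1) ^ (d / 2 * ∑ ρ, (Module.finrank ℂ (V ρ)).choose 2)

/-- `H_A` for the matrix units themselves. -/
def algebraConstant (e : UnitIndex V ≃ Fin n) (d : ℕ) : ℂ :=
  transposeSign V d * wedderburnDet a Φ E e ^ d *
    (∏ ρ, hookProduct (Module.finrank ℂ (V ρ))) ^ (d / 2 - 1)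

/-- `H_A` in the Fourier normalization. -/
def normalizedAlgebraConstant (e : UnitIndex V ≃ Fin n) (d : ℕ) : ℂ :=
  transposeSign V d * normalizedWedderburnDet a Φ E e ^ d *
    ((n : ℂ) ^ n * ∏ ρ, hookProduct (Module.finrank ℂ (V ρ)) /
      (Module.finrank ℂ (V ρ) : ℂ) ^ (Module.finrank ℂ (V ρ) ^ 2)) ^ (d / 2 - 1)

end Coordinates

end

/-! Two reductions bring everything to one matrix algebra. A hyperdeterminant is multiplied by `det
M ^ d` under a simultaneous change of basis `M` (`hyperSum_change_basis`), so the basis of `A` may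
be replaced by the matrix units pulled back along `Φ`. Products of units from different blocks
vanish, so the hypermatrix becomes block diagonal. For even `d` the first permutation can be fixed
at the cost of a factorial, and the remaining sum is multiplicative over blocks
(`reducedHyperSum_sigma`).

On a block, the form is `M ↦ tr (M B)` with `B` the transpose of `y^ρ`. Summing over the first
permutation gives a determinant of size `m²` in which `B` enters only through a right factor `B ⊗
1`, whence `det B ^ m` times the value at `B = 1`.

The constant at `B = 1` is found by induction on `d` in steps of two. For `d = 2` the Gram matrix of
the trace form is the permutation matrix of transposition, which gives the sign. For the step, the
sum over two of the permutations is recognised as the apolar pairing of `det X ^ m` with the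
degree-`d` sum for the generic form `M ↦ tr (M X)` (`hyperSum_add_two_traceForm_one`). By the
factorisation above, that sum is itself a constant times `det X ^ m`. Hence each step contributes
the sign times `⟨det X ^ m, det X ^ m⟩`, which Cayley's identity evaluates as the hook product.

That `Φ` is bijective follows from semisimplicity, Schur's lemma and Jacobson density; independence
of the matrix units is Skolem–Noether. -/

noncomputable section

/-! ### Derivations of products and determinants -/

/-- The Leibniz rule for finite products. -/
theorem Derivation.map_prod_erase {R S n : Type*} [CommRing R] [CommRing S] [Algebra R S]
    [DecidableEq n] (D : Derivation R S S) (s : Finset n) (f : n → S) :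
    D (∏ i ∈ s, f i) = ∑ r ∈ s, D (f r) * ∏ i ∈ s.erase r, f i := by
  induction s using Finset.induction_on with
  | empty => simp
  | insert a s ha ih =>
    rw [Finset.prod_insert ha, D.leibniz, ih, Finset.sum_insert ha, Finset.erase_insert ha,
      smul_eq_mul, smul_eq_mul, Finset.mul_sum, add_comm, mul_comm]
    congr 1
    refine Finset.sum_congr rfl fun r hr => ?_
    have hra : a ≠ r := fun h => ha (h ▸ hr)
    rw [Finset.erase_insert_of_ne hra, Finset.prod_insert (by simp [ha])]
    ring

/-- Jacobi's row formula for a derivation applied to a determinant. -/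
theorem Derivation.det_eq_sum_updateRow {R S n : Type*} [CommRing R] [CommRing S] [Algebra R S]
    [Fintype n] [DecidableEq n] (D : Derivation R S S) (M : Matrix n n S) :
    D M.det = ∑ r, (M.updateRow r fun j => D (M r j)).det := by
  have hdet : ∀ N : Matrix n n S,
      N.det = ∑ σ : Equiv.Perm n, ((Equiv.Perm.sign σ : ℤ) : S) * ∏ i, N i (σ i) := fun N => by
    rw [← Matrix.det_transpose, Matrix.det_apply']; rfl
  simp_rw [hdet]
  rw [map_sum, Finset.sum_comm]
  refine Finset.sum_congr rfl fun σ _ => ?_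
  rw [D.leibniz, D.map_intCast, smul_zero, add_zero, smul_eq_mul, D.map_prod_erase, Finset.mul_sum]
  refine Finset.sum_congr rfl fun r _ => ?_
  rw [← Finset.mul_prod_erase _ _ (Finset.mem_univ r)]
  congr 2
  · simp
  · refine Finset.prod_congr rfl fun i hi => ?_
    rw [Matrix.updateRow_ne (Finset.ne_of_mem_erase hi)]

/-! ### Cayley's identity -/

section Cayley

open MvPolynomial Matrix

variable (m : ℕ)

/-- The ring of polynomial functions on `m × m` matrices. -/
abbrev MatPoly : Type := MvPolynomial (Fin m × Fin m) ℂ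

/-- The generic `m × m` matrix. -/
abbrev genMat : Matrix (Fin m) (Fin m) (MatPoly m) := Matrix.mvPolynomialX (Fin m) (Fin m) ℂ

/-- The cofactor matrix of the generic matrix. -/
def genCofactor : Matrix (Fin m) (Fin m) (MatPoly m) := (genMat m).adjugateᵀ

variable {m}

theorem pderiv_genMat (i j k l : Fin m) :
    pderiv (i, j) (genMat m k l) = Matrix.single i j (1 : MatPoly m) k l := by
  simp [genMat, pderiv_X, Pi.single_apply, Matrix.single_apply, eq_comm]

theorem pderiv_det_genMat (i j : Fin m) :
    pderiv (i, j) (genMat m).det = genCofactor m i j := by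
  rw [Derivation.det_eq_sum_updateRow, Finset.sum_eq_single i]
  · rw [genCofactor, transpose_apply, adjugate_apply]
    congr 2
    ext l
    rw [pderiv_genMat]
    simp [Matrix.single_apply, Pi.single_apply, eq_comm]
  · intro r _ hr
    refine det_eq_zero_of_row_eq_zero r fun l => ?_
    rw [updateRow_self, pderiv_genMat]
    simp [hr.symm]
  · simp

/-- Differentiate `adj X * X = det X • 1` and multiply on the right by `adj X`. -/
theorem det_mul_pderiv_genCofactor (i j k l : Fin m) :
    (genMat m).det * pderiv (i, j) (genCofactor m k l) =
      genCofactor m i j * genCofactor m k l - genCofactor m i l * genCofactor m k j := by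
  set D := (pderiv (R := ℂ) (i, j) : Derivation ℂ (MatPoly m) (MatPoly m))
  have h1 : (genMat m).adjugate.map D * genMat m + (genMat m).adjugate * Matrix.single i j 1 =
      genCofactor m i j • (1 : Matrix (Fin m) (Fin m) (MatPoly m)) := by
    refine Matrix.ext fun a b => ?_
    have := congrArg D (congrFun (congrFun (adjugate_mul (genMat m)) a) b)
    rw [mul_apply, map_sum] at this
    simp only [D.leibniz, smul_eq_mul, Finset.sum_add_distrib] at this
    rw [Matrix.add_apply, mul_apply, mul_apply, add_comm]
    simp only [← pderiv_genMat]
    simp only [map_apply]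
    refine (Eq.trans ?_ this).trans ?_
    · congr 1
      exact Finset.sum_congr rfl fun _ _ => mul_comm _ _
    · rw [Matrix.smul_apply, Matrix.smul_apply, smul_eq_mul, smul_eq_mul, D.leibniz,
        ← pderiv_det_genMat]
      rw [Matrix.one_apply]
      split_ifs <;> simp [D]
  have h2 := congrArg (fun M => (M * (genMat m).adjugate) l k) h1
  simp only [Matrix.add_mul, Matrix.mul_assoc, mul_adjugate] at h2
  simp only [Matrix.add_apply, Matrix.smul_mul, Matrix.one_mul, Matrix.mul_smul, Matrix.mul_one,
    Matrix.smul_apply, smul_eq_mul, map_apply] at h2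
  have h3 : ((genMat m).adjugate * (Matrix.single i j 1 * (genMat m).adjugate) :
      Matrix (Fin m) (Fin m) (MatPoly m)) l k =
      genCofactor m i l * genCofactor m k j := by
    simp [Matrix.mul_apply, Matrix.single_apply, genCofactor, ite_and]
  rw [h3] at h2
  simp only [genCofactor, transpose_apply] at h2 ⊢
  linear_combination h2

/-- The minor of `(∂/∂x_{ij})` with rows `I` and columns `J`, as an operator. -/
def minorDiff : ∀ {k : ℕ}, (Fin k → Fin m) → (Fin k → Fin m) → MatPoly m →ₗ[ℂ] MatPoly m
  | 0, _, _ => LinearMap.id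
  | k + 1, I, J => ∑ j : Fin (k + 1), (-1 : ℂ) ^ (j : ℕ) •
      ((↑(pderiv (R := ℂ) (I 0, J j)) : MatPoly m →ₗ[ℂ] MatPoly m) ∘ₗ minorDiff (I ∘ Fin.succ) (J ∘ j.succAbove))

/-- Jacobi's row formula, with the previous identity applied to each row: the derived row is a
multiple of itself plus a multiple of row `i` of the cofactor matrix. -/
theorem det_mul_pderiv_minor {k : ℕ} (i j : Fin m) (I J : Fin k → Fin m) :
    (genMat m).det * pderiv (i, j) ((genCofactor m).submatrix I J).det =
      k * (genCofactor m i j * ((genCofactor m).submatrix I J).det) -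
      ∑ r, genCofactor m (I r) j *
        (((genCofactor m).submatrix I J).updateRow r fun b => genCofactor m i (J b)).det := by
  rw [Derivation.det_eq_sum_updateRow, Finset.mul_sum]
  have hk : (k : MatPoly m) * (genCofactor m i j * ((genCofactor m).submatrix I J).det) =
      ∑ r : Fin k, genCofactor m i j * ((genCofactor m).submatrix I J).det := by simp
  rw [hk, ← Finset.sum_sub_distrib]
  refine Finset.sum_congr rfl fun r _ => ?_
  have hs := det_updateRow_smul ((genCofactor m).submatrix I J) r (genMat m).det
    fun b => pderiv (i, j) (((genCofactor m).submatrix I J) r b)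
  have : ((genMat m).det • fun b => pderiv (i, j) (((genCofactor m).submatrix I J) r b)) =
      genCofactor m i j • ((genCofactor m).submatrix I J) r +
        (- genCofactor m (I r) j) • fun b => genCofactor m i (J b) := by
    ext b : 1
    simp only [Pi.smul_apply, smul_eq_mul, submatrix_apply, Pi.add_apply,
      det_mul_pderiv_genCofactor]
    ring
  rw [this, det_updateRow_add, det_updateRow_smul, det_updateRow_smul, updateRow_eq_self] at hs
  rw [← hs]
  simp [sub_eq_add_neg]

/-- The factor `det ^ k` on the left clears the negative powers that would appear for `s < k`. The
induction expands the operator along its first row. The new factor `s + k` has two sources: `s` from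
the Laplace expansion, and `1` from each of the `k` lower rows, whose correction term is the same
minor with that row and the first exchanged. -/
theorem det_pow_mul_minorDiff_det_pow (s : ℕ) {k : ℕ} (I J : Fin k → Fin m) :
    (genMat m).det ^ k * minorDiff I J ((genMat m).det ^ s) =
      (∏ i ∈ Finset.range k, ((s + i : ℕ) : MatPoly m)) * (genMat m).det ^ s *
        ((genCofactor m).submatrix I J).det := by
  induction k with
  | zero => simp [minorDiff]
  | succ k ih =>
    set D := (genMat m).det with hD
    set P := (∏ i ∈ Finset.range k, ((s + i : ℕ) : MatPoly m)) with hP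
    set K := genCofactor m with hK
    have key : ∀ j : Fin (k + 1), D ^ (k + 1) * pderiv (I 0, J j)
        (minorDiff (I ∘ Fin.succ) (J ∘ j.succAbove) (D ^ s)) =
        P * D ^ s * (s * (K (I 0) (J j) * (K.submatrix (I ∘ Fin.succ) (J ∘ j.succAbove)).det) -
          ∑ r, K (I (Fin.succ r)) (J j) * ((K.submatrix (I ∘ Fin.succ)
            (J ∘ j.succAbove)).updateRow r fun b => K (I 0) (J (j.succAbove b))).det) := by
      intro j
      have h0 := ih (I ∘ Fin.succ) (J ∘ j.succAbove)
      have h1 := congrArg (fun p => D * pderiv (I 0, J j) p) h0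
      have hPder : pderiv (I 0, J j) P = 0 := by
        rw [hP, ← Nat.cast_prod, Derivation.map_natCast]
      have hpow : ∀ t : ℕ, D * pderiv (I 0, J j) (D ^ t) = t * D ^ t * K (I 0) (J j) := by
        intro t
        rw [pderiv_pow, hD, pderiv_det_genMat, ← hD]
        cases t with
        | zero => simp
        | succ t => simp; ring
      have hmin := det_mul_pderiv_minor (I 0) (J j) (I ∘ Fin.succ) (J ∘ j.succAbove)
      simp only [pderiv_mul, hPder] at h1
      rw [← hD, ← hK] at hmin
      have hk := hpow k
      have hs := hpow s
      simp only [Function.comp_apply] at hmin h0 h1 ⊢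
      -- The terms `k * K (I 0) (J j)` coming from `det ^ k` and from the derivative of the minor
      -- cancel.
      linear_combination h1 - (minorDiff (I ∘ Fin.succ) (J ∘ j.succAbove) (D ^ s)) * hk
        + P * (K.submatrix (I ∘ Fin.succ) (J ∘ j.succAbove)).det * hs + P * D ^ s * hmin
        - k * K (I 0) (J j) * h0
    have hrow : ∀ r : Fin k, ∑ j : Fin (k + 1), (-1 : MatPoly m) ^ (j : ℕ) *
        (K (I (Fin.succ r)) (J j) * ((K.submatrix (I ∘ Fin.succ)
          (J ∘ j.succAbove)).updateRow r fun b => K (I 0) (J (j.succAbove b))).det) =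
        - (K.submatrix I J).det := by
      intro r
      have hsw := det_permute (Equiv.swap 0 (Fin.succ r)) (K.submatrix I J)
      rw [Equiv.Perm.sign_swap (Fin.succ_ne_zero r).symm] at hsw
      have hneg : - (K.submatrix I J).det = (((-1 : ℤˣ) : ℤ) : MatPoly m) * (K.submatrix I J).det := by
        simp
      rw [hneg, ← hsw, det_succ_row_zero]
      refine Finset.sum_congr rfl fun j _ => ?_
      simp only [submatrix_apply, Equiv.swap_apply_left, id, mul_assoc, submatrix_submatrix]
      congr 3
      ext a b
      rcases eq_or_ne a r with rfl | har
      · simp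
      · rw [updateRow_ne har]
        simp [Equiv.swap_apply_of_ne_of_ne (Fin.succ_ne_zero a)
          (fun h => har (Fin.succ_injective _ h))]
    have hlap := det_succ_row_zero (K.submatrix I J)
    simp only [minorDiff, LinearMap.sum_apply, LinearMap.smul_apply, LinearMap.comp_apply,
      Derivation.coeFn_coe]
    rw [Finset.mul_sum]
    have hsm : ∀ (j : ℕ) (p : MatPoly m), (-1 : ℂ) ^ j • p = (-1 : MatPoly m) ^ j * p := by
      intro j p
      rw [Algebra.smul_def]; simp
    have : ∀ j : Fin (k + 1), D ^ (k + 1) * ((-1 : ℂ) ^ (j : ℕ) • pderiv (I 0, J j)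
        (minorDiff (I ∘ Fin.succ) (J ∘ j.succAbove) (D ^ s))) =
        P * D ^ s * (s * ((-1 : MatPoly m) ^ (j : ℕ) * (K.submatrix I J) 0 j *
          ((K.submatrix I J).submatrix Fin.succ j.succAbove).det)) -
        P * D ^ s * ∑ r, (-1 : MatPoly m) ^ (j : ℕ) * (K (I (Fin.succ r)) (J j) *
          ((K.submatrix (I ∘ Fin.succ)
            (J ∘ j.succAbove)).updateRow r fun b => K (I 0) (J (j.succAbove b))).det) := by
      intro j
      rw [hsm, mul_left_comm, key j, ← Finset.mul_sum, submatrix_submatrix]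
      simp only [submatrix_apply]
      ring
    rw [Finset.sum_congr rfl fun j _ => this j, Finset.sum_sub_distrib, ← Finset.mul_sum,
      ← Finset.mul_sum, ← Finset.mul_sum, ← hlap, Finset.sum_comm,
      Finset.sum_congr rfl fun r _ => hrow r, Finset.prod_range_succ, ← hP]
    simp
    ring

/-- **Cayley's identity** `det(∂) det(X)^(s+1) = (s+1)(s+2)⋯(s+m) det(X)^s`. -/
theorem cayley_identity (s : ℕ) :
    minorDiff id id ((genMat m).det ^ (s + 1)) =
      (∏ i ∈ Finset.range m, ((s + 1 + i : ℕ) : ℂ)) • (genMat m).det ^ s := by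
  have h := det_pow_mul_minorDiff_det_pow (s + 1) (id : Fin m → Fin m) id
  have hD : (genMat m).det ≠ 0 := Matrix.det_mvPolynomialX_ne_zero (Fin m) ℂ
  apply mul_left_cancel₀ (pow_ne_zero m hD)
  rw [h, submatrix_id_id, genCofactor, det_transpose, det_adjugate, Fintype.card_fin, smul_eq_C_mul,
    map_prod]
  simp only [map_natCast]
  -- The exponent `m - 1` of `det (adj X)` is truncated at `m = 0`.
  cases m with
  | zero => simp
  | succ m => simp; ring

end Cayley

/-! ### The apolar pairing and the norm of a power of the determinant -/

section Apolar

open MvPolynomial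

variable {τ : Type*} [Fintype τ]

/-- The apolar pairing on polynomials, for which `∂/∂x_j` is adjoint to multiplication by `x_j`. -/
def apolar : MvPolynomial τ ℂ →ₗ[ℂ] MvPolynomial τ ℂ →ₗ[ℂ] ℂ :=
  (basisMonomials τ ℂ).constr ℂ fun α => (∏ j, ((α j).factorial : ℂ)) • lcoeff ℂ α

theorem apolar_monomial (α : τ →₀ ℕ) (q : MvPolynomial τ ℂ) :
    apolar (monomial α 1) q = (∏ j, ((α j).factorial : ℂ)) * coeff α q := by
  have := (basisMonomials τ ℂ).constr_basis ℂ
    (fun α => (∏ j, ((α j).factorial : ℂ)) • lcoeff ℂ α) α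
  rw [coe_basisMonomials] at this
  rw [apolar, this]
  simp

theorem apolar_one (q : MvPolynomial τ ℂ) : apolar 1 q = coeff 0 q := by
  have := apolar_monomial 0 q
  simpa using this

theorem apolar_X_mul [DecidableEq τ] (j : τ) (p q : MvPolynomial τ ℂ) :
    apolar (X j * p) q = apolar p (pderiv j q) := by
  induction p using MvPolynomial.induction_on' with
  | add p p' hp hp' => rw [mul_add, map_add, map_add, LinearMap.add_apply, hp, hp',
      LinearMap.add_apply]
  | monomial α c =>
    have hc : (monomial α c : MvPolynomial τ ℂ) = c • monomial α 1 := by simp [smul_monomial]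
    rw [hc, mul_smul_comm, map_smul, map_smul, LinearMap.smul_apply, LinearMap.smul_apply,
      X, monomial_mul, one_mul, apolar_monomial, apolar_monomial, coeff_pderiv, add_comm]
    congr 1
    rw [← Finset.mul_prod_erase _ _ (Finset.mem_univ j),
      ← Finset.mul_prod_erase Finset.univ (fun i => ((α i).factorial : ℂ)) (Finset.mem_univ j)]
    have : ∀ i ∈ Finset.univ.erase j, (((α + Finsupp.single j 1 : τ →₀ ℕ) i).factorial : ℂ) =
        ((α i).factorial : ℂ) := fun i hi => by
      simp [Finsupp.single_eq_of_ne (Finset.ne_of_mem_erase hi)]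
    rw [Finset.prod_congr rfl this]
    simp [Nat.factorial_succ]
    ring

/-- Enumerating the complement of `r` by `swap 0 r` matches `Equiv.Perm.decomposeFin`, as the
induction for the permanent requires. -/
theorem prod_erase_eq_prod_swap_succ {M : Type*} [CommMonoid M] {k : ℕ} (f : Fin (k + 1) → M)
    (r : Fin (k + 1)) :
    ∏ i ∈ Finset.univ.erase r, f i = ∏ i : Fin k, f (Equiv.swap 0 r i.succ) := by
  refine (Finset.prod_bij (fun i _ => Equiv.swap 0 r i.succ) ?_ ?_ ?_ fun _ _ => rfl).symm
  · intro i _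
    rw [Finset.mem_erase]
    refine ⟨fun h => ?_, Finset.mem_univ _⟩
    rw [Equiv.swap_apply_eq_iff, Equiv.swap_apply_right] at h
    exact Fin.succ_ne_zero i h
  · intro i _ i' _ h
    exact Fin.succ_injective _ ((Equiv.swap 0 r).injective h)
  · intro i hi
    have : Equiv.swap 0 r i ≠ 0 := fun h => by
      rw [Equiv.swap_apply_eq_iff, Equiv.swap_apply_left] at h
      exact Finset.ne_of_mem_erase hi h
    obtain ⟨x, hx⟩ := Fin.exists_succ_eq.mpr this
    exact ⟨x, Finset.mem_univ _, by rw [hx, Equiv.swap_apply_self]⟩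

/-- Moving `X (j 0)` across the pairing differentiates the product of linear forms; the Leibniz rule
then expands the permanent along one variable. -/
theorem apolar_prod_fin [DecidableEq τ] {k : ℕ} (j : Fin k → τ) (c : Fin k → τ → ℂ) :
    apolar (∏ i, X (j i)) (∏ i, ∑ t, c i t • X t) =
      ∑ ρ : Equiv.Perm (Fin k), ∏ i, c (ρ i) (j i) := by
  induction k with
  | zero => simp [apolar_one]
  | succ k ih =>
    have hd : ∀ r, pderiv (j 0) (∑ t, c r t • X t) = C (c r (j 0)) := fun r => by
      rw [map_sum, Finset.sum_eq_single (j 0)]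
      · rw [Derivation.map_smul, pderiv_X_self, smul_eq_C_mul, mul_one]
      · intro t _ ht
        rw [Derivation.map_smul, pderiv_X_of_ne ht, smul_zero]
      · simp
    rw [Fin.prod_univ_succ, apolar_X_mul, Derivation.map_prod_erase, map_sum,
      ← Equiv.Perm.decomposeFin.symm.sum_comp, Fintype.sum_prod_type]
    refine Finset.sum_congr rfl fun r _ => ?_
    rw [hd, ← smul_eq_C_mul, map_smul, prod_erase_eq_prod_swap_succ,
      ih (fun i => j i.succ) (fun i => c (Equiv.swap 0 r i.succ)), smul_eq_mul, Finset.mul_sum]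
    refine Finset.sum_congr rfl fun ρ _ => ?_
    rw [Fin.prod_univ_succ]
    simp

/-- The apolar pairing of a product of variables with a product of linear forms is a permanent. -/
theorem apolar_prod [DecidableEq τ] {κ : Type*} [Fintype κ] [DecidableEq κ] (j : κ → τ) (c : κ → τ → ℂ) :
    apolar (∏ i, X (j i)) (∏ i, ∑ t, c i t • X t) =
      ∑ ρ : Equiv.Perm κ, ∏ i, c i (j (ρ i)) := by
  let e := Fintype.equivFin κ
  have h := apolar_prod_fin (fun i => j (e.symm i)) (fun i => c (e.symm i))
  rw [e.symm.prod_comp (fun i => X (j i)), e.symm.prod_comp (fun i => ∑ t, c i t • X t)] at h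
  rw [h]
  refine Fintype.sum_equiv ((Equiv.inv (Equiv.Perm (Fin _))).trans e.symm.permCongr) _ _
    fun ρ => Fintype.prod_equiv (ρ.trans e.symm) _ _ fun i => ?_
  simp

variable {m : ℕ}

/-- Since `X j` and `∂/∂x_j` are adjoint, so are a minor of the generic matrix and the same minor in
the derivatives. -/
theorem apolar_minor_mul {k : ℕ} (I J : Fin k → Fin m) (p q : MatPoly m) :
    apolar (((genMat m).submatrix I J).det * p) q = apolar p (minorDiff I J q) := by
  induction k generalizing p with
  | zero => simp [minorDiff]
  | succ k ih =>
    rw [Matrix.det_succ_row_zero, Finset.sum_mul, map_sum, LinearMap.sum_apply, minorDiff,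
      LinearMap.sum_apply, map_sum]
    refine Finset.sum_congr rfl fun j _ => ?_
    have : (-1 : MatPoly m) ^ (j : ℕ) * (genMat m).submatrix I J 0 j *
        (((genMat m).submatrix I J).submatrix Fin.succ j.succAbove).det * p =
        (-1 : ℂ) ^ (j : ℕ) • ((((genMat m).submatrix (I ∘ Fin.succ) (J ∘ j.succAbove)).det) *
          (X (I 0, J j) * p)) := by
      rw [Algebra.smul_def, Matrix.submatrix_submatrix]
      simp
      ring
    rw [this, map_smul, LinearMap.smul_apply, ih, apolar_X_mul, LinearMap.smul_apply, map_smul]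
    rfl

/-- One factor `det` moves across as `det(∂)`, and Cayley's identity lowers the exponent on the
other side. -/
theorem apolar_det_pow (s : ℕ) :
    apolar ((genMat m).det ^ s) ((genMat m).det ^ s) =
      ∏ t ∈ Finset.range s, ∏ i ∈ Finset.range m, ((t + 1 + i : ℕ) : ℂ) := by
  induction s with
  | zero => simp [apolar_one]
  | succ s ih =>
    have h := apolar_minor_mul (id : Fin m → Fin m) id ((genMat m).det ^ s)
      ((genMat m).det ^ (s + 1))
    rw [Matrix.submatrix_id_id, ← pow_succ', cayley_identity, map_smul, ih] at h
    rw [h, Finset.prod_range_succ, smul_eq_mul, mul_comm]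

theorem apolar_det_pow_self :
    apolar ((genMat m).det ^ m) ((genMat m).det ^ m) = hookProduct m := by
  rw [apolar_det_pow, hookProduct, Finset.prod_comm]
  refine Finset.prod_congr rfl fun i _ => ?_
  rw [eq_div_iff (by exact_mod_cast Nat.factorial_ne_zero i)]
  have : ∀ k : ℕ, (∏ t ∈ Finset.range k, ((t + 1 + i : ℕ) : ℂ)) * (i.factorial : ℂ) =
      ((k + i).factorial : ℂ) := fun k => by
    induction k with
    | zero => simp
    | succ k ih =>
      rw [Finset.prod_range_succ, mul_right_comm, ih, show k + 1 + i = (k + i) + 1 by ring,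
        Nat.factorial_succ]
      push_cast
      ring
  exact this m

end Apolar

/-! ### Sums over tuples of permutations -/

open Equiv

/-- The sum over tuples of permutations in Cayley's hyperdeterminant, for any finite index type. -/
def hyperSum {I R : Type*} [Fintype I] [DecidableEq I] [CommRing R] (d : ℕ)
    (Y : (Fin d → I) → R) : R :=
  ∑ σ : Fin d → Perm I, (∏ k, ((Perm.sign (σ k) : ℤ) : R)) * ∏ i, Y fun k => σ k i

theorem hyperSum_succ {I R : Type*} [Fintype I] [DecidableEq I] [CommRing R] (d : ℕ)
    (Y : (Fin (d + 1) → I) → R) :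
    hyperSum (d + 1) Y = ∑ σ₀ : Perm I, ∑ σ : Fin d → Perm I,
      ((Perm.sign σ₀ : ℤ) : R) * (∏ k, ((Perm.sign (σ k) : ℤ) : R)) *
        ∏ i, Y (Fin.cons (σ₀ i) fun k => σ k i) := by
  rw [hyperSum, ← (Fin.consEquiv fun _ => Perm I).sum_comp, Fintype.sum_prod_type]
  refine Finset.sum_congr rfl fun σ₀ _ => Finset.sum_congr rfl fun σ _ => ?_
  rw [Fin.prod_univ_succ]
  congr 1
  refine Finset.prod_congr rfl fun i _ => congrArg Y ?_
  ext k
  refine Fin.cases ?_ (fun k => ?_) k <;> rfl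

theorem hyperSum_add_two {I R : Type*} [Fintype I] [DecidableEq I] [CommRing R] (d : ℕ)
    (Y : (Fin (d + 2) → I) → R) :
    hyperSum (d + 2) Y = ∑ σ : Fin d → Perm I, (∏ k, ((Perm.sign (σ k) : ℤ) : R)) *
      ∑ σ₀ : Perm I, ∑ σ₁ : Perm I, ((Perm.sign σ₀ : ℤ) : R) * ((Perm.sign σ₁ : ℤ) : R) *
        ∏ i, Y (Fin.cons (σ₀ i) (Fin.cons (σ₁ i) fun k => σ k i : Fin (d + 1) → I)) := by
  simp only [Finset.mul_sum]
  rw [hyperSum_succ, Finset.sum_comm (s := Finset.univ (α := Fin d → Perm I))]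
  refine Finset.sum_congr rfl fun σ₀ _ => ?_
  rw [← (Fin.consEquiv fun _ => Perm I).sum_comp, Fintype.sum_prod_type, Finset.sum_comm]
  refine Finset.sum_congr rfl fun σ _ => Finset.sum_congr rfl fun σ₁ _ => ?_
  rw [Fin.prod_univ_succ, ← mul_assoc, ← mul_assoc]
  congr 1
  · simp [Fin.consEquiv]
    ring
  · refine Finset.prod_congr rfl fun i _ => congrArg Y (congrArg _ ?_)
    ext k
    refine Fin.cases ?_ (fun k => ?_) k <;> rfl

theorem det_eq_sum_row {n R : Type*} [Fintype n] [DecidableEq n] [CommRing R] (M : Matrix n n R) :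
    M.det = ∑ σ : Perm n, ((Perm.sign σ : ℤ) : R) * ∏ i, M i (σ i) := by
  rw [← Matrix.det_transpose, Matrix.det_apply']
  rfl

/-- Transposition is an involution fixing the `m` diagonal pairs, hence a product of `(m² - m) / 2`
swaps. -/
theorem sign_prodComm_fin (m : ℕ) :
    Perm.sign (Equiv.prodComm (Fin m) (Fin m) : Perm (Fin m × Fin m)) = (-1) ^ m.choose 2 := by
  rw [Perm.sign_of_pow_two_eq_one (by ext x <;> simp [pow_two])]
  have h : Fintype.card (Function.fixedPoints
      ⇑(Equiv.prodComm (Fin m) (Fin m) : Perm (Fin m × Fin m))) = m := by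
    refine (Fintype.card_congr (β := Fin m) ⟨fun x => x.1.1, fun i => ⟨(i, i), rfl⟩, fun x => ?_, fun i => rfl⟩).trans
      (Fintype.card_fin m)
    obtain ⟨⟨i, j⟩, hx⟩ := x
    have : j = i := congrArg Prod.fst hx
    subst this
    rfl
  rw [h, Nat.choose_two_right, Fintype.card_prod, Fintype.card_fin, Nat.mul_sub, mul_one]

theorem sum_perm_eq_sum_prodCongrRight {α β M : Type*} [Fintype α] [DecidableEq α] [Fintype β]
    [DecidableEq β] [AddCommMonoid M] (F : Perm (α × β) → M)
    (hF : ∀ π, (¬ ∀ k, (π k).1 = k.1) → F π = 0) :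
    ∑ π, F π = ∑ π : α → Perm β, F (Equiv.prodCongrRight π) := by
  classical
  symm
  refine Finset.sum_of_injOn (fun π => Equiv.prodCongrRight π) ?_ (by simp) ?_ fun _ _ => rfl
  · intro π _ π' _ h
    ext a b
    exact congrArg Prod.snd (Equiv.congr_fun h (a, b))
  · intro π _ hπ
    refine hF π fun hk => hπ ?_
    have hinj : ∀ a, Function.Injective fun b => (π (a, b)).2 := fun a b b' h => by
      have := π.injective (Prod.ext ((hk (a, b)).trans (hk (a, b')).symm) h)
      simpa using this
    refine ⟨fun a => Equiv.ofBijective _ (Finite.injective_iff_bijective.mp (hinj a)),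
      by simp, ?_⟩
    ext ⟨a, b⟩
    · exact (hk (a, b)).symm
    · rfl

/-! ### The hyperdeterminant of a matrix algebra -/

section MatrixUnits

open Matrix MvPolynomial

variable {m : ℕ}

/-- The product of the matrix units indexed by `J`. -/
def unitProd {d : ℕ} (J : Fin d → Fin m × Fin m) : Matrix (Fin m) (Fin m) ℂ :=
  (List.ofFn fun k => Matrix.single (J k).1 (J k).2 (1 : ℂ)).prod

theorem unitProd_cons {d : ℕ} (j : Fin m × Fin m) (J : Fin d → Fin m × Fin m) :
    unitProd (Fin.cons j J : Fin (d + 1) → Fin m × Fin m) =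
      Matrix.single j.1 j.2 1 * unitProd J := by
  simp [unitProd, List.ofFn_succ]

variable {R : Type*} [CommRing R] [Algebra ℂ R]

/-- The trace form `M ↦ tr (M B)` on complex matrices. -/
def traceForm (B : Matrix (Fin m) (Fin m) R) (M : Matrix (Fin m) (Fin m) ℂ) : R :=
  ∑ t : Fin m × Fin m, M t.2 t.1 • B t.1 t.2

theorem traceForm_single_mul (B : Matrix (Fin m) (Fin m) R) (j : Fin m × Fin m)
    (M : Matrix (Fin m) (Fin m) ℂ) :
    traceForm B (Matrix.single j.1 j.2 1 * M) = ∑ c, M j.2 c • B c j.1 := by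
  rw [traceForm, Fintype.sum_prod_type]
  refine Finset.sum_congr rfl fun c _ => ?_
  rw [Finset.sum_eq_single j.1]
  · simp
  · intro b _ hb
    simp [Matrix.single_mul_apply_of_ne _ _ _ _ _ hb]
  · simp

/-- With the other permutations fixed, the sum over the first is the determinant of `(i, j) ↦ tr
(e_j U_i B)`. This matrix is its value at `B = 1` times `B ⊗ 1`, and `det (B ⊗ 1) = det B ^ m`. -/
theorem hyperSum_traceForm_eq_det_pow_mul (d : ℕ) (B : Matrix (Fin m) (Fin m) R) :
    hyperSum (d + 1) (fun J => traceForm B (unitProd J)) =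
      B.det ^ m * hyperSum (d + 1) fun J => traceForm (1 : Matrix (Fin m) (Fin m) R) (unitProd J) := by
  have key : ∀ (C : Matrix (Fin m) (Fin m) R),
      hyperSum (d + 1) (fun J => traceForm C (unitProd J)) =
      ∑ σ : Fin d → Perm (Fin m × Fin m), (∏ k, ((Perm.sign (σ k) : ℤ) : R)) *
        (Matrix.of fun (i j : Fin m × Fin m) =>
          traceForm C (Matrix.single j.1 j.2 1 * unitProd fun k => σ k i)).det := fun C => by
    rw [hyperSum_succ, Finset.sum_comm]
    refine Finset.sum_congr rfl fun σ _ => ?_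
    rw [det_eq_sum_row, Finset.mul_sum]
    refine Finset.sum_congr rfl fun σ₀ _ => ?_
    simp only [unitProd_cons, Matrix.of_apply]
    ring
  rw [key, key, Finset.mul_sum]
  refine Finset.sum_congr rfl fun σ _ => ?_
  have : (Matrix.of fun (i j : Fin m × Fin m) =>
      traceForm B (Matrix.single j.1 j.2 1 * unitProd fun k => σ k i)) =
      (Matrix.of fun (i j : Fin m × Fin m) => traceForm (1 : Matrix (Fin m) (Fin m) R)
        (Matrix.single j.1 j.2 1 * unitProd fun k => σ k i)) *
          kroneckerMap (· * ·) B (1 : Matrix (Fin m) (Fin m) R) := by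
    ext i j
    simp only [Matrix.mul_apply, Matrix.of_apply, traceForm_single_mul, Fintype.sum_prod_type]
    refine Finset.sum_congr rfl fun c _ => ?_
    simp [Matrix.one_apply]
  rw [this, det_mul, det_kronecker]
  simp
  ring

/-- Since `tr (e_a e_b)` is `1` when `b` is the transpose of `a` and `0` otherwise, every choice of
the first permutation contributes the sign of transposition. -/
theorem hyperSum_two_traceForm_one :
    hyperSum 2 (fun J => traceForm (1 : Matrix (Fin m) (Fin m) ℂ) (unitProd J)) =
      ((m * m).factorial : ℂ) * (-1) ^ m.choose 2 := by
  have hN : ∀ σ : Perm (Fin m × Fin m), (Matrix.of fun (i j : Fin m × Fin m) =>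
      traceForm (1 : Matrix (Fin m) (Fin m) ℂ)
        (Matrix.single (σ i).1 (σ i).2 1 * Matrix.single j.1 j.2 1)) =
      Perm.permMatrix ℂ ((Equiv.prodComm (Fin m) (Fin m) : Perm (Fin m × Fin m)) * σ) := by
    intro σ
    ext i j
    rw [of_apply, traceForm_single_mul]
    simp [Matrix.one_apply, Matrix.single_apply, Equiv.toPEquiv_apply, PEquiv.toMatrix_apply,
      Prod.ext_iff, ite_and, eq_comm]
  have hu : ∀ a b : Fin m × Fin m, unitProd (Fin.cons a (Fin.cons b Fin.elim0) : Fin 2 → _) =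
      Matrix.single a.1 a.2 1 * Matrix.single b.1 b.2 (1 : ℂ) := fun a b => by
    rw [unitProd_cons, unitProd_cons]; simp [unitProd]
  rw [hyperSum_succ]
  have : ∀ σ₀ : Perm (Fin m × Fin m), (∑ σ : Fin 1 → Perm (Fin m × Fin m),
      ((Perm.sign σ₀ : ℤ) : ℂ) * (∏ k, ((Perm.sign (σ k) : ℤ) : ℂ)) *
        ∏ i, traceForm (1 : Matrix (Fin m) (Fin m) ℂ)
          (unitProd (Fin.cons (σ₀ i) fun k => σ k i : Fin 2 → _))) = (-1) ^ m.choose 2 := by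
    intro σ₀
    have h := congrArg det (hN σ₀)
    rw [det_eq_sum_row, det_permutation, map_mul, sign_prodComm_fin] at h
    have hs : ((Perm.sign σ₀ : ℤ) : ℂ) * ((Perm.sign σ₀ : ℤ) : ℂ) = 1 := by
      rw [← Int.cast_mul, ← Units.val_mul, Int.units_mul_self]; simp
    rw [← (Equiv.funUnique (Fin 1) (Perm (Fin m × Fin m))).symm.sum_comp]
    have h' := congrArg (fun z => ((Perm.sign σ₀ : ℤ) : ℂ) * z) h
    simp only [Finset.mul_sum] at h'
    refine Eq.trans (Finset.sum_congr rfl fun σ₁ _ => ?_) (h'.trans ?_)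
    · rw [← mul_assoc]
      congr 1
      · simp
      · refine Finset.prod_congr rfl fun i _ => ?_
        rw [of_apply, ← hu]
        congr 3
        ext k : 1
        rw [Fin.eq_zero k]
        rfl
    · push_cast
      linear_combination (-1) ^ m.choose 2 * hs
  rw [Finset.sum_congr rfl fun σ₀ _ => this σ₀]
  simp [Fintype.card_perm]

/-- The `m` permutations, one per factor, are read as a single permutation of `Fin m × Fin m`
preserving the first coordinate; this is the shape in which they arise from traces of products. -/
theorem det_genMat_pow_eq :
    (genMat m).det ^ m = ∑ π : Fin m → Perm (Fin m),
      ((Perm.sign (Equiv.prodCongrRight π : Perm (Fin m × Fin m)) : ℤ) : ℂ) • ∏ k : Fin m × Fin m,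
        X (k.2, (Equiv.prodCongrRight π k).2) := by
  have : (genMat m).det ^ m = ∏ _b : Fin m, (genMat m).det := by simp
  rw [this, det_eq_sum_row, Finset.prod_univ_sum, Fintype.piFinset_univ]
  refine Finset.sum_congr rfl fun π _ => ?_
  rw [Perm.sign_prodCongrRight, Finset.prod_mul_distrib, Algebra.smul_def]
  congr 1
  · simp
  · rw [Fintype.prod_prod_type]
    rfl

theorem traceForm_one_single_mul_single_mul (k j : Fin m × Fin m) (U : Matrix (Fin m) (Fin m) ℂ) :
    traceForm (1 : Matrix (Fin m) (Fin m) ℂ)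
      (Matrix.single k.2 k.1 1 * (Matrix.single j.1 j.2 1 * U)) =
      if j.1 = k.1 then U j.2 k.2 else 0 := by
  rw [traceForm_single_mul _ (k.2, k.1)]
  simp only [Matrix.one_apply, smul_eq_mul, mul_ite, mul_one, mul_zero, Finset.sum_ite_eq',
    Finset.mem_univ, if_true]
  split_ifs with h
  · rw [h]; simp
  · exact Matrix.single_mul_apply_of_ne _ _ _ _ _ (Ne.symm h) _

/-- Write the first two permutations as `w * ρ` and `π * ρ` with `w` the transposition of pairs. The
trace is nonzero only if `π` preserves first coordinates, and the signs reduce to `sign w * sign π`.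
The signed sum over such `π` assembles `det X ^ m`, while the sum over `ρ` is the permanent that
`apolar_prod` turns into a pairing with `∏ i, tr (U_i X)`. -/
theorem hyperSum_add_two_traceForm_one (d : ℕ) :
    hyperSum (d + 2) (fun J => traceForm (1 : Matrix (Fin m) (Fin m) ℂ) (unitProd J)) =
      (-1) ^ m.choose 2 * apolar ((genMat m).det ^ m)
        (hyperSum d fun J => traceForm (genMat m) (unitProd J)) := by
  set w : Perm (Fin m × Fin m) := Equiv.prodComm (Fin m) (Fin m) with hw
  have hsw : ((Perm.sign w : ℤ) : ℂ) = (-1) ^ m.choose 2 := by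
    rw [hw, sign_prodComm_fin]; simp
  have hL : ∀ σ : Fin d → Perm (Fin m × Fin m),
      (∑ σ₀ : Perm (Fin m × Fin m), ∑ σ₁ : Perm (Fin m × Fin m),
        ((Perm.sign σ₀ : ℤ) : ℂ) * ((Perm.sign σ₁ : ℤ) : ℂ) *
        ∏ i, traceForm (1 : Matrix (Fin m) (Fin m) ℂ)
          (unitProd (Fin.cons (σ₀ i) (Fin.cons (σ₁ i) fun k => σ k i : Fin (d + 1) → _)))) =
      ∑ ρ : Perm (Fin m × Fin m), ∑ π : Fin m → Perm (Fin m), (-1) ^ m.choose 2 *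
        (((Perm.sign (Equiv.prodCongrRight π : Perm (Fin m × Fin m)) : ℤ) : ℂ) *
          ∏ i, unitProd (fun k => σ k i) (Equiv.prodCongrRight π (ρ i)).2 (ρ i).2) := by
    intro σ
    rw [← Equiv.sum_comp (Equiv.mulLeft w)]
    refine Finset.sum_congr rfl fun ρ _ => ?_
    have hρ : ((Perm.sign ρ : ℤ) : ℂ) * ((Perm.sign ρ : ℤ) : ℂ) = 1 := by
      rw [← Int.cast_mul, ← Units.val_mul, Int.units_mul_self]; simp
    have hterm : ∀ (π : Perm (Fin m × Fin m)) (i : Fin m × Fin m),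
        traceForm (1 : Matrix (Fin m) (Fin m) ℂ) (unitProd (Fin.cons ((w * ρ) i)
          (Fin.cons ((π * ρ) i) fun k => σ k i : Fin (d + 1) → _))) =
        if (π (ρ i)).1 = (ρ i).1 then unitProd (fun k => σ k i) (π (ρ i)).2 (ρ i).2 else 0 := by
      intro π i
      rw [unitProd_cons, unitProd_cons, ← traceForm_one_single_mul_single_mul]
      rfl
    rw [← Equiv.sum_comp (Equiv.mulRight ρ), sum_perm_eq_sum_prodCongrRight]
    · refine Finset.sum_congr rfl fun π _ => ?_
      rw [Equiv.coe_mulLeft, Equiv.coe_mulRight, Finset.prod_congr rfl fun i _ => hterm _ i,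
        Perm.sign_mul, Perm.sign_mul]
      have : ∀ i, (Equiv.prodCongrRight π (ρ i)).1 = (ρ i).1 := fun i => rfl
      simp only [this, if_true]
      push_cast
      rw [hsw]
      linear_combination ((-1) ^ m.choose 2 *
        (((Perm.sign (Equiv.prodCongrRight π : Perm (Fin m × Fin m)) : ℤ) : ℂ) *
          ∏ i, unitProd (fun k => σ k i) (Equiv.prodCongrRight π (ρ i)).2 (ρ i).2)) * hρ
    · intro π hπ
      push Not at hπ
      obtain ⟨k, hk⟩ := hπ
      rw [Equiv.coe_mulLeft, Equiv.coe_mulRight, Finset.prod_congr rfl fun i _ => hterm _ i,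
        Finset.prod_eq_zero (Finset.mem_univ (ρ.symm k)), mul_zero]
      simp [hk]
  rw [hyperSum_add_two, Finset.sum_congr rfl fun σ _ => congrArg _ (hL σ), hyperSum, map_sum,
    Finset.mul_sum]
  refine Finset.sum_congr rfl fun σ _ => ?_
  have hs : (∏ k, ((Perm.sign (σ k) : ℤ) : MatPoly m)) =
      algebraMap ℂ (MatPoly m) (∏ k, ((Perm.sign (σ k) : ℤ) : ℂ)) := by
    rw [map_prod]; simp
  rw [hs, ← Algebra.smul_def, map_smul, smul_eq_mul, mul_left_comm]
  congr 1
  rw [det_genMat_pow_eq, map_sum, LinearMap.sum_apply, Finset.mul_sum, Finset.sum_comm]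
  refine Finset.sum_congr rfl fun π _ => ?_
  have hap := apolar_prod (fun k : Fin m × Fin m => (k.2, (Equiv.prodCongrRight π k).2))
    (fun i t => unitProd (fun k => σ k i) t.2 t.1)
  rw [map_smul, LinearMap.smul_apply]
  simp only [traceForm, Matrix.mvPolynomialX_apply]
  rw [hap, ← Finset.mul_sum, ← Finset.mul_sum, smul_eq_mul]

theorem hyperSum_traceForm_one_eq_algebraMap (d : ℕ) :
    hyperSum d (fun J => traceForm (1 : Matrix (Fin m) (Fin m) R) (unitProd J)) =
      algebraMap ℂ R (hyperSum d fun J =>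
        traceForm (1 : Matrix (Fin m) (Fin m) ℂ) (unitProd J)) := by
  simp [hyperSum, traceForm, Matrix.one_apply, map_sum, map_prod, apply_ite (algebraMap ℂ R),
    Algebra.smul_def]

/-- The hyperdeterminant sum of the algebra of `m × m` matrices over `ℂ` with its trace form. -/
theorem hyperSum_traceForm_one (e : ℕ) :
    hyperSum (2 * e + 2) (fun J => traceForm (1 : Matrix (Fin m) (Fin m) ℂ) (unitProd J)) =
      ((m * m).factorial : ℂ) * ((-1) ^ m.choose 2) ^ (e + 1) * hookProduct m ^ e := by
  induction e with
  | zero => rw [mul_zero, zero_add, hyperSum_two_traceForm_one]; ring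
  | succ e ih =>
    rw [mul_add, mul_one, hyperSum_add_two_traceForm_one, hyperSum_traceForm_eq_det_pow_mul]
    rw [hyperSum_traceForm_one_eq_algebraMap, ih, mul_comm ((genMat m).det ^ m),
      ← Algebra.smul_def, map_smul, apolar_det_pow_self,
      smul_eq_mul]
    ring

/-- The hyperdeterminant sum of the algebra of `m × m` matrices with the form `M ↦ tr (M B)`. -/
theorem hyperSum_traceForm (e : ℕ) (B : Matrix (Fin m) (Fin m) R) :
    hyperSum (2 * e + 2) (fun J => traceForm B (unitProd J)) =
      algebraMap ℂ R (((m * m).factorial : ℂ) * ((-1) ^ m.choose 2) ^ (e + 1) *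
        hookProduct m ^ e) * B.det ^ m := by
  rw [hyperSum_traceForm_eq_det_pow_mul, hyperSum_traceForm_one_eq_algebraMap,
    hyperSum_traceForm_one, mul_comm]

end MatrixUnits

/-! ### Change of basis and block diagonal hypermatrices -/

/-- A hyperdeterminant sum transforms by `det M ^ d` under a simultaneous change of basis `M`. -/
theorem hyperSum_change_basis {I R : Type*} [Fintype I] [DecidableEq I] [CommRing R] (d : ℕ)
    (M : Matrix I I R) (Y : (Fin d → I) → R) :
    hyperSum d (fun K => ∑ J : Fin d → I, (∏ k, M (J k) (K k)) * Y J) =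
      M.det ^ d * hyperSum d Y := by
  have h1 : hyperSum d (fun K => ∑ J : Fin d → I, (∏ k, M (J k) (K k)) * Y J) =
      ∑ F : Fin d → I → I, (∏ k, (M.submatrix (F k) id).det) * ∏ i, Y fun k => F k i := by
    rw [hyperSum, ← (Equiv.piComm fun (_ : I) (_ : Fin d) => I).sum_comp]
    simp only [Finset.prod_univ_sum, Fintype.piFinset_univ, Finset.mul_sum]
    rw [Finset.sum_comm]
    refine Finset.sum_congr rfl fun F _ => ?_
    simp only [det_eq_sum_row, Finset.prod_univ_sum, Fintype.piFinset_univ, Finset.sum_mul]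
    refine Finset.sum_congr rfl fun σ _ => ?_
    rw [Finset.prod_mul_distrib, Finset.prod_mul_distrib, Finset.prod_comm (s := Finset.univ),
      mul_assoc]
    rfl
  rw [h1, hyperSum, Finset.mul_sum]
  -- A non-injective `F k` repeats a row of `M`, so only tuples of permutations survive.
  symm
  refine Finset.sum_of_injOn (fun (σ : Fin d → Perm I) k => ⇑(σ k)) ?_ (by simp) ?_ ?_
  · intro σ _ σ' _ h
    funext k
    exact DFunLike.coe_injective (congrFun h k)
  · intro F _ hF
    have : ∃ k, ¬ Function.Injective (F k) := by
      by_contra! hinj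
      exact hF ⟨fun k => Equiv.ofBijective _ (Finite.injective_iff_bijective.mp (hinj k)),
        by simp, rfl⟩
    obtain ⟨k, hk⟩ := this
    simp only [Function.Injective, not_forall] at hk
    obtain ⟨i, i', h, hne⟩ := hk
    rw [Finset.prod_eq_zero (Finset.mem_univ k), zero_mul]
    exact Matrix.det_zero_of_row_eq hne (by ext; simp [h])
  · intro σ _
    simp only [Matrix.det_permute, Finset.prod_mul_distrib, Finset.prod_const, Finset.card_univ,
      Fintype.card_fin]
    ring

/-- The hyperdeterminant sum with the first permutation fixed to be the identity. -/
def reducedHyperSum {I R : Type*} [Fintype I] [DecidableEq I] [CommRing R] (d : ℕ)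
    (Y : (Fin (d + 1) → I) → R) : R :=
  ∑ σ : Fin d → Perm I, (∏ k, ((Perm.sign (σ k) : ℤ) : R)) *
    ∏ i, Y (Fin.cons i fun k => σ k i)

/-- Right translation of the other permutations by the first one changes the sign by `sign σ₀ ^ (d +
1) = 1`, by parity. The reduced sum is needed because it is multiplicative over blocks, whereas the
factorials are not. -/
theorem hyperSum_eq_factorial_mul {I R : Type*} [Fintype I] [DecidableEq I] [CommRing R] {d : ℕ}
    (hd : Even (d + 1)) (Y : (Fin (d + 1) → I) → R) :
    hyperSum (d + 1) Y = ((Fintype.card I).factorial : R) * reducedHyperSum d Y := by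
  rw [hyperSum_succ]
  have : ∀ σ₀ : Perm I, (∑ σ : Fin d → Perm I,
      ((Perm.sign σ₀ : ℤ) : R) * (∏ k, ((Perm.sign (σ k) : ℤ) : R)) *
        ∏ i, Y (Fin.cons (σ₀ i) fun k => σ k i)) = reducedHyperSum d Y := by
    intro σ₀
    rw [reducedHyperSum, ← Equiv.sum_comp (Equiv.mulRight (fun _ : Fin d => σ₀))]
    refine Finset.sum_congr rfl fun σ _ => ?_
    have hs : (((Perm.sign σ₀ : ℤˣ) : ℤ) : R) ^ (d + 1) = 1 := by
      obtain ⟨c, hc⟩ := hd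
      rw [hc, ← two_mul, pow_mul, ← Int.cast_pow, ← Units.val_pow_eq_pow_val, Int.units_sq]
      simp
    congr 1
    · simp only [Equiv.coe_mulRight, Pi.mul_apply, Perm.sign_mul, Units.val_mul, Int.cast_mul,
        Finset.prod_mul_distrib, Finset.prod_const, Finset.card_univ, Fintype.card_fin]
      rw [mul_left_comm, ← pow_succ', hs, mul_one]
    · exact Equiv.prod_comp σ₀ fun i => Y (Fin.cons i fun k => σ k i)
  rw [Finset.sum_congr rfl fun σ₀ _ => this σ₀]
  simp [Fintype.card_perm]

theorem exists_eq_sigmaCongrRight {ι : Type*} {β : ι → Type*} [∀ ρ, Finite (β ρ)]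
    (σ : Perm (Σ ρ, β ρ)) (hσ : ∀ i, (σ i).1 = i.1) :
    ∃ π : ∀ ρ, Perm (β ρ), Perm.sigmaCongrRight π = σ := by
  have : ∀ ρ (b : β ρ), ∃ b' : β ρ, σ ⟨ρ, b⟩ = ⟨ρ, b'⟩ := fun ρ b => by
    have h := hσ ⟨ρ, b⟩
    rcases hi : σ ⟨ρ, b⟩ with ⟨ρ', b'⟩
    rw [hi] at h
    subst h
    exact ⟨b', rfl⟩
  choose g hg using this
  have hinj : ∀ ρ, Function.Injective (g ρ) := fun ρ b b' h => by
    have := σ.injective ((hg ρ b).trans ((congrArg _ h).trans (hg ρ b').symm))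
    simpa using this
  refine ⟨fun ρ => Equiv.ofBijective _ (Finite.injective_iff_bijective.mp (hinj ρ)), ?_⟩
  ext1 ⟨ρ, b⟩
  exact (hg ρ b).symm

section Sigma

variable {ι : Type*} [Fintype ι] [DecidableEq ι] {β : ι → Type*} [∀ ρ, Fintype (β ρ)]
  [∀ ρ, DecidableEq (β ρ)]

/-- Both sides are homomorphisms on the product of the groups, so they need only agree on each
factor. -/
theorem sign_sigmaCongrRight (π : ∀ ρ, Perm (β ρ)) :
    Perm.sign (Perm.sigmaCongrRight π) = ∏ ρ, Perm.sign (π ρ) := by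
  let f : (∀ ρ, Perm (β ρ)) →* ℤˣ := Perm.sign.comp (Perm.sigmaCongrRightHom β)
  let g : (∀ ρ, Perm (β ρ)) →* ℤˣ :=
    { toFun := fun π => ∏ ρ, Perm.sign (π ρ)
      map_one' := by simp
      map_mul' := fun _ _ => by simp [Finset.prod_mul_distrib] }
  suffices f = g from DFunLike.congr_fun this π
  refine MonoidHom.pi_ext fun ρ σ => ?_
  have hg : g (Pi.mulSingle ρ σ) = Perm.sign σ := by
    change ∏ ρ', Perm.sign ((Pi.mulSingle ρ σ : ∀ ρ, Perm (β ρ)) ρ') = _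
    rw [Finset.prod_eq_single ρ]
    · simp
    · intro ρ' _ h
      simp [Pi.mulSingle_eq_of_ne h]
    · simp
  rw [hg]
  change Perm.sign (Perm.sigmaCongrRight (Pi.mulSingle ρ σ)) = _
  symm
  refine Perm.sign_bij (fun b _ => (⟨ρ, b⟩ : Σ ρ, β ρ)) ?_ ?_ ?_
  · intro b _ _
    simp [Perm.sigmaCongrRight]
  · intro b b' _ _ h
    simpa using h
  · rintro ⟨ρ', b⟩ h
    rcases eq_or_ne ρ' ρ with rfl | hne
    · refine ⟨b, fun hb => h ?_, rfl⟩
      simp [Perm.sigmaCongrRight, hb]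
    · exact absurd (by simp [Perm.sigmaCongrRight, Pi.mulSingle_eq_of_ne hne]) h

/-- The reduced hyperdeterminant sum of a block diagonal hypermatrix. -/
theorem reducedHyperSum_sigma {R : Type*} [CommRing R] (d : ℕ)
    (Y : (Fin (d + 1) → Σ ρ, β ρ) → R) (hY : ∀ J, (∃ k, (J k).1 ≠ (J 0).1) → Y J = 0) :
    reducedHyperSum d Y = ∏ ρ, reducedHyperSum d fun J => Y fun k => ⟨ρ, J k⟩ := by
  have hR : ∏ ρ, reducedHyperSum d (fun J => Y fun k => ⟨ρ, J k⟩) =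
      ∑ π : Fin d → ∀ ρ, Perm (β ρ),
        (∏ k, ((Perm.sign (Perm.sigmaCongrRight (π k)) : ℤ) : R)) *
          ∏ i, Y (Fin.cons i fun k => Perm.sigmaCongrRight (π k) i) := by
    simp only [reducedHyperSum, Finset.prod_univ_sum, Fintype.piFinset_univ]
    rw [← (Equiv.piComm fun (_ : Fin d) ρ => Perm (β ρ)).sum_comp]
    refine Finset.sum_congr rfl fun π _ => ?_
    rw [Finset.prod_mul_distrib, Fintype.prod_sigma, Finset.prod_comm]
    congr 1
    · refine Finset.prod_congr rfl fun k _ => ?_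
      rw [sign_sigmaCongrRight, Units.coe_prod, Int.cast_prod]
      rfl
    · refine Finset.prod_congr rfl fun ρ _ => Finset.prod_congr rfl fun b _ => congrArg Y ?_
      ext1 k
      refine Fin.cases ?_ (fun k => ?_) k <;> rfl
  rw [hR, reducedHyperSum]
  symm
  refine Finset.sum_of_injOn
    (fun (π : Fin d → ∀ ρ, Perm (β ρ)) k => Perm.sigmaCongrRight (π k)) ?_ (by simp) ?_ ?_
  · intro π _ π' _ h
    funext k
    exact Perm.sigmaCongrRightHom_injective (congrFun h k)
  -- The first index is `i` itself, so a permutation moving some `i` out of its block produces an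
  -- off-block entry, which is zero.
  · intro σ _ hσ
    have : ∃ k i, (σ k i).1 ≠ i.1 := by
      by_contra! h
      choose π hπ using fun k => exists_eq_sigmaCongrRight (σ k) (h k)
      exact hσ ⟨π, by simp, funext hπ⟩
    obtain ⟨k, i, hki⟩ := this
    rw [Finset.prod_eq_zero (Finset.mem_univ i), mul_zero]
    exact hY _ ⟨k.succ, by simpa using hki⟩
  · intro π _
    rfl

end Sigma

/-! ### Bijectivity of `Φ` -/

section Wedderburn

variable {A : Type u} [Ring A] [Algebra ℂ A] {ι : Type w} {V : ι → Type v}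
  [∀ ρ, AddCommGroup (V ρ)] [∀ ρ, Module ℂ (V ρ)] [∀ ρ, Module A (V ρ)]
  [∀ ρ, IsScalarTower ℂ A (V ρ)]

theorem finiteDimensional_of_isSimpleModule [Module.Finite ℂ A] (M : Type v) [AddCommGroup M]
    [Module ℂ M] [Module A M] [IsScalarTower ℂ A M] [IsSimpleModule A M] : Module.Finite ℂ M :=
  Module.Finite.trans A M

/-- Schur's lemma: `f` minus an eigenvalue is `A`-linear and not injective, hence zero. -/
theorem exists_smul_of_isSimpleModule [Module.Finite ℂ A] (M : Type v) [AddCommGroup M]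
    [Module ℂ M] [Module A M] [IsScalarTower ℂ A M] [IsSimpleModule A M] (f : Module.End A M) :
    ∃ c : ℂ, ∀ x, f x = c • x := by
  have := finiteDimensional_of_isSimpleModule (A := A) M
  have := IsSimpleModule.nontrivial A M
  obtain ⟨c, hc⟩ := Module.End.exists_eigenvalue (f.restrictScalars ℂ)
  obtain ⟨x, hx⟩ := hc.exists_hasEigenvector
  refine ⟨c, ?_⟩
  have hlin : ∀ (r : ℂ) (a : A) (y : M), r • a • y = a • r • y := fun r a y => by
    rw [← algebraMap_smul A r (a • y), ← algebraMap_smul A r y, smul_smul, smul_smul,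
      Algebra.commutes]
  let g : Module.End A M :=
    { toFun := fun y => f y - c • y
      map_add' := fun y z => by rw [map_add, smul_add]; abel
      map_smul' := fun a y => by
        rw [map_smul, hlin, RingHom.id_apply, smul_sub] }
  rcases g.bijective_or_eq_zero with h | h
  · exact absurd (h.1 (show g x = g 0 by
      rw [map_zero]; exact sub_eq_zero.mpr hx.apply_eq_smul)) hx.2
  · exact fun y => sub_eq_zero.mp (LinearMap.congr_fun h y)

/-- An element of the kernel annihilates every simple left ideal; these span `A`, so it annihilates
`1`. -/
theorem wedderburnHom_injective [IsSemisimpleRing A] (hV : IsCompleteSetOfSimples A V) :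
    Function.Injective (wedderburnHom A V) := by
  rw [injective_iff_map_eq_zero]
  intro a ha
  have hsimple : ∀ S : Submodule A A, IsSimpleModule A S → ∀ s ∈ S, a * s = 0 := by
    intro S hS s hs
    obtain ⟨ρ, ⟨e⟩⟩ := hV.complete S hS
    have h : a • e ⟨s, hs⟩ = 0 := LinearMap.congr_fun (congrFun ha ρ) (e ⟨s, hs⟩)
    rw [← map_smul, LinearEquiv.map_eq_zero_iff] at h
    exact congrArg Subtype.val h
  have htop := IsSemisimpleModule.sSup_simples_eq_top A A
  have h1 : (1 : A) ∈ sSup {m : Submodule A A | IsSimpleModule A m} := by rw [htop]; trivial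
  suffices ∀ s ∈ sSup {m : Submodule A A | IsSimpleModule A m}, a * s = 0 by
    simpa using this 1 h1
  intro s hs
  rw [sSup_eq_iSup'] at hs
  induction hs using Submodule.iSup_induction' with
  | mem S s hs => exact hsimple S.1 S.2 s hs
  | zero => simp
  | add x y _ _ hx hy => rw [mul_add, hx, hy, add_zero]

/-- By Schur's lemma and inequivalence, an `A`-endomorphism of `∏ V ρ` is a scalar on each factor,
so any family `f` commutes with it. Jacobson density then realises `f` by an element of `A` on a
finite spanning set over `ℂ`, hence everywhere. -/
theorem wedderburnHom_surjective [Finite ι] [Module.Finite ℂ A] [IsSemisimpleRing A]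
    (hV : IsCompleteSetOfSimples A V) : Function.Surjective (wedderburnHom A V) := by
  classical
  have := Fintype.ofFinite ι
  have := hV.simple
  have := fun ρ => finiteDimensional_of_isSimpleModule (A := A) (V ρ)
  intro f
  have hcomm : ∀ (g : Module.End A (∀ ρ, V ρ)) (x : ∀ ρ, V ρ),
      (fun ρ => f ρ (g x ρ)) = g fun ρ => f ρ (x ρ) := by
    intro g
    have hg : ∀ ρ, ∃ c : ℂ, ∀ x, g x ρ = c • x ρ := by
      intro ρ
      obtain ⟨c, hc⟩ := exists_smul_of_isSimpleModule (A := A) (V ρ)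
        (LinearMap.proj ρ ∘ₗ g ∘ₗ LinearMap.single A V ρ)
      refine ⟨c, fun x => ?_⟩
      have hx : x = ∑ σ, LinearMap.single A V σ (x σ) := by
        simp [LinearMap.sum_single_apply]
      conv_lhs => rw [hx]
      rw [map_sum, Finset.sum_apply, Finset.sum_eq_single ρ]
      · exact hc (x ρ)
      · intro σ _ hσ
        let t : V σ →ₗ[A] V ρ := LinearMap.proj ρ ∘ₗ g ∘ₗ LinearMap.single A V σ
        rcases t.bijective_or_eq_zero with h | h
        · exact absurd (hV.inequivalent σ ρ ⟨LinearEquiv.ofBijective t h⟩) hσ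
        · exact LinearMap.congr_fun h (x σ)
      · simp
    choose c hc using hg
    intro x
    ext ρ
    rw [hc, map_smul, hc]
  let F : Module.End (Module.End A (∀ ρ, V ρ)) (∀ ρ, V ρ) :=
    { toFun := fun x ρ => f ρ (x ρ)
      map_add' := fun x y => by ext; simp
      map_smul' := fun g x => hcomm g x }
  obtain ⟨s, hs⟩ := Module.Finite.fg_top (R := ℂ) (M := ∀ ρ, V ρ)
  obtain ⟨r, hr⟩ := jacobson_density F s
  refine ⟨r, ?_⟩
  have hall : ∀ x : ∀ ρ, V ρ, F x = r • x := by
    intro x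
    induction hs.ge (trivial : x ∈ ⊤) using Submodule.span_induction with
    | mem x hx => exact hr x hx
    | zero => simp
    | add x y _ _ hx hy => rw [map_add, hx, hy, smul_add]
    | smul c x _ hx =>
      have hF : F (c • x) = c • F x := by ext ρ; exact map_smul (f ρ) c (x ρ)
      rw [hF, hx]
      ext ρ
      change c • r • x ρ = r • c • x ρ
      rw [← algebraMap_smul A c (r • x ρ), ← algebraMap_smul A c (x ρ), smul_smul, smul_smul,
        Algebra.commutes]
  ext ρ y
  have := congrFun (hall (Pi.single ρ y)) ρ
  simp only [Pi.smul_apply, Pi.single_eq_same] at this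
  exact this.symm.trans (by simp [F])

end Wedderburn

/-! ### Matrix units and independence of their choice -/

section MatrixUnitAlgebra

open Matrix

variable {W : Type v} [AddCommGroup W] [Module ℂ W] {m : ℕ}
  (E : Module.Basis (Fin m × Fin m) ℂ (Module.End ℂ W))

/-- The linear equivalence carrying the elementary matrices to a basis of matrix units. -/
def matrixUnitsLinearEquiv : Matrix (Fin m) (Fin m) ℂ ≃ₗ[ℂ] Module.End ℂ W :=
  (Matrix.stdBasis ℂ (Fin m) (Fin m)).equiv E (Equiv.refl _)

theorem matrixUnitsLinearEquiv_single (i j : Fin m) :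
    matrixUnitsLinearEquiv E (Matrix.single i j 1) = E (i, j) := by
  rw [← Matrix.stdBasis_eq_single, matrixUnitsLinearEquiv, Module.Basis.equiv_apply]
  rfl

variable {E}

theorem matrixUnitsLinearEquiv_mul (hE : IsMatrixUnits E) (M N : Matrix (Fin m) (Fin m) ℂ) :
    matrixUnitsLinearEquiv E (M * N) =
      matrixUnitsLinearEquiv E M * matrixUnitsLinearEquiv E N := by
  let φ := (matrixUnitsLinearEquiv E).toLinearMap
  suffices (LinearMap.mul ℂ _).compr₂ φ = (LinearMap.mul ℂ _).compl₁₂ φ φ from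
    LinearMap.congr_fun₂ this M N
  refine (Matrix.stdBasis ℂ (Fin m) (Fin m)).ext fun p =>
    (Matrix.stdBasis ℂ (Fin m) (Fin m)).ext fun q => ?_
  obtain ⟨i, j⟩ := p
  obtain ⟨k, l⟩ := q
  simp only [Matrix.stdBasis_eq_single, LinearMap.compr₂_apply, LinearMap.compl₁₂_apply,
    LinearMap.mul_apply', φ, LinearEquiv.coe_coe, matrixUnitsLinearEquiv_single, hE i j k l]
  split_ifs with h
  · subst h
    rw [Matrix.single_mul_single_same, mul_one, matrixUnitsLinearEquiv_single]
  · rw [Matrix.single_mul_single_of_ne _ _ _ _ h, map_zero]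

/-- The algebra equivalence carrying the elementary matrices to a basis of matrix units. -/
def matrixUnitsEquiv (hE : IsMatrixUnits E) : Matrix (Fin m) (Fin m) ℂ ≃ₐ[ℂ] Module.End ℂ W :=
  AlgEquiv.ofLinearEquiv (matrixUnitsLinearEquiv E)
    (by
      obtain ⟨M, hM⟩ := (matrixUnitsLinearEquiv E).surjective 1
      rw [← mul_one (matrixUnitsLinearEquiv E 1), ← hM, ← matrixUnitsLinearEquiv_mul hE, one_mul])
    (matrixUnitsLinearEquiv_mul hE)

theorem matrixUnitsEquiv_single (hE : IsMatrixUnits E) (i j : Fin m) :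
    matrixUnitsEquiv hE (Matrix.single i j 1) = E (i, j) :=
  matrixUnitsLinearEquiv_single E i j

/-- A linear map on `End W` is a trace form in terms of its values on matrix units. -/
theorem apply_matrixUnitsEquiv {R : Type*} [CommRing R] [Algebra ℂ R] (hE : IsMatrixUnits E)
    (ℓ : Module.End ℂ W →ₗ[ℂ] R) (M : Matrix (Fin m) (Fin m) ℂ) :
    ℓ (matrixUnitsEquiv hE M) = traceForm (Matrix.of fun i j => ℓ (E (i, j)))ᵀ M := by
  conv_lhs => rw [Matrix.matrix_eq_sum_single M]
  simp only [map_sum, traceForm, Fintype.sum_prod_type]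
  rw [Finset.sum_comm]
  refine Finset.sum_congr rfl fun j _ => Finset.sum_congr rfl fun i _ => ?_
  have : Matrix.single i j (M i j) = M i j • Matrix.single i j (1 : ℂ) := by simp
  rw [this, map_smul, map_smul, matrixUnitsEquiv_single]
  rfl

/-- The determinant of the values of a linear map on matrix units does not depend on the choice of
the matrix units. -/
theorem det_apply_matrixUnits_eq {R : Type*} [CommRing R] [Algebra ℂ R]
    {E' : Module.Basis (Fin m × Fin m) ℂ (Module.End ℂ W)} (hE : IsMatrixUnits E)
    (hE' : IsMatrixUnits E') (ℓ : Module.End ℂ W →ₗ[ℂ] R) :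
    (Matrix.of fun i j => ℓ (E (i, j))).det = (Matrix.of fun i j => ℓ (E' (i, j))).det := by
  -- Skolem–Noether: the passage between two systems of matrix units is an automorphism of the
  -- matrix algebra, hence conjugation by some `P` with inverse `Q`.
  obtain ⟨T, hT⟩ := AlgEquiv.eq_linearEquivConjAlgEquiv
    ((Matrix.toLinAlgEquiv'.symm.trans (matrixUnitsEquiv hE')).trans
      ((matrixUnitsEquiv hE).symm.trans Matrix.toLinAlgEquiv'))
  set P := LinearMap.toMatrixAlgEquiv' T.toLinearMap with hP
  set Q := LinearMap.toMatrixAlgEquiv' T.symm.toLinearMap with hQ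
  have hPQ : P * Q = 1 := by
    have : T.toLinearMap * T.symm.toLinearMap = 1 :=
      LinearMap.ext T.apply_symm_apply
    rw [hP, hQ, ← map_mul, this, map_one]
  have hconj : ∀ M, matrixUnitsEquiv hE' M = matrixUnitsEquiv hE (P * M * Q) := by
    intro M
    have h := DFunLike.congr_fun hT (Matrix.toLinAlgEquiv' M)
    apply (matrixUnitsEquiv hE).symm.injective
    rw [AlgEquiv.symm_apply_apply]
    apply Matrix.toLinAlgEquiv'.injective
    have h2 : Matrix.toLinAlgEquiv' (P * M * Q) = T.conjAlgEquiv ℂ (Matrix.toLinAlgEquiv' M) := by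
      rw [map_mul, map_mul, LinearEquiv.conjAlgEquiv_apply, hP, hQ,
        Matrix.toLinAlgEquiv'_toMatrixAlgEquiv', Matrix.toLinAlgEquiv'_toMatrixAlgEquiv']
      rfl
    rw [h2, ← h]
    simp
  have hmat : (Matrix.of fun i j => ℓ (E' (i, j))) =
      (P.map (algebraMap ℂ R))ᵀ * (Matrix.of fun i j => ℓ (E (i, j))) *
        (Q.map (algebraMap ℂ R))ᵀ := by
    ext i j
    rw [of_apply, ← matrixUnitsEquiv_single hE', hconj, apply_matrixUnitsEquiv hE]
    have hs : ∀ a b, (P * Matrix.single i j 1 * Q : Matrix (Fin m) (Fin m) ℂ) a b = P a i * Q j b := fun a b => by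
      simp [Matrix.mul_apply, Matrix.single_apply, ite_and]
    simp only [traceForm, hs, Fintype.sum_prod_type, Matrix.mul_apply, Finset.sum_mul,
      transpose_apply, of_apply, map_apply, Algebra.smul_def, map_mul]
    refine Finset.sum_congr rfl fun b _ => Finset.sum_congr rfl fun a _ => ?_
    ring
  rw [hmat, det_mul, det_mul, det_transpose, det_transpose, mul_right_comm, ← det_mul,
    ← Matrix.map_mul, hPQ]
  simp

end MatrixUnitAlgebra

/-! ### Assembly for a general semisimple algebra -/

section AlgebraHypermatrix

open MvPolynomial

/-- Reindexing of a hyperdeterminant sum. -/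
theorem hyperSum_equiv {I I' R : Type*} [Fintype I] [DecidableEq I] [Fintype I'] [DecidableEq I']
    [CommRing R] (d : ℕ) (e : I ≃ I') (Y : (Fin d → I) → R) :
    hyperSum d (fun J : Fin d → I' => Y fun k => e.symm (J k)) = hyperSum d Y := by
  rw [hyperSum, hyperSum, ← (Equiv.piCongrRight fun _ : Fin d => e.permCongr).sum_comp]
  refine Finset.sum_congr rfl fun σ _ => ?_
  congr 1
  · simp
  · rw [← e.prod_comp]
    simp

theorem hookProduct_ne_zero (m : ℕ) : hookProduct m ≠ 0 :=
  Finset.prod_ne_zero_iff.mpr fun _ _ => div_ne_zero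
    (Nat.cast_ne_zero.mpr (Nat.factorial_ne_zero _)) (Nat.cast_ne_zero.mpr (Nat.factorial_ne_zero _))

variable {A : Type u} [Ring A] [Algebra ℂ A] {n : ℕ} (a : Module.Basis (Fin n) ℂ A)

/-- The generic linear form as a linear map. -/
def genericFormLinear : A →ₗ[ℂ] MvPolynomial (Fin n) ℂ where
  toFun := genericForm a
  map_add' x y := by simp [genericForm, add_mul, Finset.sum_add_distrib]
  map_smul' c x := by
    simp [genericForm, Finset.smul_sum, smul_eq_C_mul, mul_assoc]

theorem prod_ofFn_sum_smul {κ : Type*} [Fintype κ] [DecidableEq κ] {d : ℕ} (c : Fin d → κ → ℂ)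
    (v : κ → A) :
    (List.ofFn fun k => ∑ j, c k j • v j).prod =
      ∑ J : Fin d → κ, (∏ k, c k (J k)) • (List.ofFn fun k => v (J k)).prod := by
  have h := (MultilinearMap.mkPiAlgebraFin ℂ d A).map_sum fun k j => c k j • v j
  simp only [MultilinearMap.mkPiAlgebraFin_apply] at h
  rw [h]
  refine Finset.sum_congr rfl fun J _ => ?_
  have := (MultilinearMap.mkPiAlgebraFin ℂ d A).map_smul_univ (fun k => c k (J k))
    fun k => v (J k)
  simpa only [MultilinearMap.mkPiAlgebraFin_apply] using this

variable {ι : Type w} [Fintype ι] [DecidableEq ι] {V : ι → Type v}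
  [∀ ρ, AddCommGroup (V ρ)] [∀ ρ, Module ℂ (V ρ)]
  (Φ : A ≃ₐ[ℂ] ∀ ρ, Module.End ℂ (V ρ))
  (E : ∀ ρ, Module.Basis
    (Fin (Module.finrank ℂ (V ρ)) × Fin (Module.finrank ℂ (V ρ))) ℂ (Module.End ℂ (V ρ)))

/-- The basis element of `A` corresponding to a matrix unit. -/
def pulledUnit (p : UnitIndex V) : A := Φ.symm (Pi.single p.1 (E p.1 p.2))

theorem basis_eq_sum_pulledUnit (k : Fin n) :
    a k = ∑ p, wedderburnMatrix a Φ E p k • pulledUnit Φ E p := by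
  apply Φ.injective
  rw [map_sum]
  conv_lhs => rw [← (Pi.basis E).sum_repr (Φ (a k))]
  refine Finset.sum_congr rfl fun p _ => ?_
  rw [map_smul, pulledUnit, AlgEquiv.apply_symm_apply, Pi.basis_apply, wedderburnMatrix,
    LinearMap.toMatrix_apply]
  rfl

theorem hyperSum_algebraHypermatrix (e : UnitIndex V ≃ Fin n) (d : ℕ) :
    hyperSum d (algebraHypermatrix a d) = C (wedderburnDet a Φ E e) ^ d *
      hyperSum d fun J : Fin d → UnitIndex V =>
        genericForm a (List.ofFn fun k => pulledUnit Φ E (J k)).prod := by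
  have h : algebraHypermatrix a d = fun K => ∑ J : Fin d → Fin n,
      (∏ k, (C.mapMatrix ((wedderburnMatrix a Φ E).submatrix e.symm id)) (J k) (K k)) *
        genericForm a (List.ofFn fun k => pulledUnit Φ E (e.symm (J k))).prod := by
    funext K
    have ha : ∀ k, a (K k) = ∑ j : Fin n, wedderburnMatrix a Φ E (e.symm j) (K k) •
        pulledUnit Φ E (e.symm j) := fun k => by
      rw [e.symm.sum_comp fun p => wedderburnMatrix a Φ E p (K k) • pulledUnit Φ E p,
        ← basis_eq_sum_pulledUnit]
    rw [algebraHypermatrix]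
    simp only [ha]
    rw [prod_ofFn_sum_smul (fun k j => wedderburnMatrix a Φ E (e.symm j) (K k))
      fun j => pulledUnit Φ E (e.symm j)]
    change genericFormLinear a _ = _
    rw [map_sum]
    refine Finset.sum_congr rfl fun J _ => ?_
    rw [map_smul, smul_eq_C_mul, map_prod]
    rfl
  rw [h, hyperSum_change_basis, ← RingHom.map_det, wedderburnDet]
  congr 1
  exact hyperSum_equiv d e fun J : Fin d → UnitIndex V =>
    genericForm a (List.ofFn fun k => pulledUnit Φ E (J k)).prod

omit [Fintype ι] in
theorem map_prod_ofFn_pulledUnit {d : ℕ} (J : Fin d → UnitIndex V) (ρ : ι) :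
    Φ (List.ofFn fun k => pulledUnit Φ E (J k)).prod ρ =
      (List.ofFn fun k => (Pi.single (J k).1 (E (J k).1 (J k).2) :
        ∀ ρ, Module.End ℂ (V ρ)) ρ).prod := by
  refine (map_list_prod ((Pi.evalMonoidHom (fun ρ => Module.End ℂ (V ρ)) ρ).comp
    (Φ : A →* ∀ ρ, Module.End ℂ (V ρ))) _).trans ?_
  rw [List.map_ofFn]
  refine congrArg (fun f => (List.ofFn f).prod) (funext fun k => ?_)
  exact congrFun (Φ.apply_symm_apply _) ρ

omit [Fintype ι] in
theorem prod_pulledUnit_eq_zero {d : ℕ} (J : Fin (d + 1) → UnitIndex V)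
    (hJ : ∃ k, (J k).1 ≠ (J 0).1) : (List.ofFn fun k => pulledUnit Φ E (J k)).prod = 0 := by
  apply Φ.injective
  rw [map_zero]
  funext ρ
  rw [map_prod_ofFn_pulledUnit]
  apply List.prod_eq_zero
  rw [List.mem_ofFn]
  obtain ⟨k, hk⟩ := hJ
  rcases eq_or_ne ρ (J 0).1 with rfl | h
  · exact ⟨k, Pi.single_eq_of_ne hk.symm _⟩
  · exact ⟨0, Pi.single_eq_of_ne h _⟩

omit [Fintype ι] in
theorem prod_pulledUnit_block {E} (hE : ∀ ρ, IsMatrixUnits (E ρ)) {d : ℕ} (ρ : ι)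
    (J : Fin (d + 1) → Fin (Module.finrank ℂ (V ρ)) × Fin (Module.finrank ℂ (V ρ))) :
    (List.ofFn fun k => pulledUnit Φ E ⟨ρ, J k⟩).prod =
      Φ.symm (Pi.single ρ (matrixUnitsEquiv (hE ρ) (unitProd J))) := by
  apply Φ.injective
  rw [AlgEquiv.apply_symm_apply]
  funext σ
  rw [map_prod_ofFn_pulledUnit Φ E fun k => ⟨ρ, J k⟩]
  rcases eq_or_ne σ ρ with rfl | h
  · simp only [Pi.single_eq_same, unitProd, map_list_prod, List.map_ofFn]
    simp [Function.comp_def, matrixUnitsEquiv_single]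
  · rw [Pi.single_eq_of_ne h]
    exact List.prod_eq_zero (List.mem_ofFn.mpr ⟨0, Pi.single_eq_of_ne h _⟩)

omit [Fintype ι] in
-- The transpose appears because `∑ M_ij y_ij = tr (M yᵀ)`; determinants do not see it.
theorem genericForm_matrixUnits {E} (hE : ∀ ρ, IsMatrixUnits (E ρ)) (ρ : ι)
    (M : Matrix (Fin (Module.finrank ℂ (V ρ))) (Fin (Module.finrank ℂ (V ρ))) ℂ) :
    genericForm a (Φ.symm (Pi.single ρ (matrixUnitsEquiv (hE ρ) M))) =
      traceForm (wedderburnCoord a Φ E ρ).transpose M :=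
  apply_matrixUnitsEquiv (hE ρ) (genericFormLinear a ∘ₗ Φ.symm.toLinearMap ∘ₗ
    LinearMap.single ℂ (fun ρ => Module.End ℂ (V ρ)) ρ) M

omit [Fintype ι] in
theorem reducedHyperSum_block {E} (hE : ∀ ρ, IsMatrixUnits (E ρ)) (c : ℕ) (ρ : ι) :
    reducedHyperSum (2 * c + 1) (fun J => genericForm a
      (List.ofFn fun k => pulledUnit Φ E ⟨ρ, J k⟩).prod) =
      C (((-1) ^ (Module.finrank ℂ (V ρ)).choose 2) ^ (c + 1) *
        hookProduct (Module.finrank ℂ (V ρ)) ^ c) *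
          (wedderburnCoord a Φ E ρ).det ^ Module.finrank ℂ (V ρ) := by
  have hpar : Even (2 * c + 1 + 1) := ⟨c + 1, by ring⟩
  have hN : (((Module.finrank ℂ (V ρ) * Module.finrank ℂ (V ρ)).factorial : ℕ) :
      MvPolynomial (Fin n) ℂ) ≠ 0 := Nat.cast_ne_zero.mpr (Nat.factorial_ne_zero _)
  -- The matrix algebra was computed with the full sum; the factor `(m²)!` passes from it to the
  -- reduced one.
  apply mul_left_cancel₀ hN
  have h1 := hyperSum_eq_factorial_mul hpar (fun J => genericForm a
      (List.ofFn fun k => pulledUnit Φ E ⟨ρ, J k⟩).prod)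
  rw [Fintype.card_prod, Fintype.card_fin] at h1
  rw [← h1]
  simp only [prod_pulledUnit_block Φ hE, genericForm_matrixUnits a Φ hE]
  rw [hyperSum_traceForm, Matrix.det_transpose, MvPolynomial.algebraMap_eq]
  simp only [map_mul, map_natCast]
  ring

omit [DecidableEq ι] in
theorem card_unitIndex : Fintype.card (UnitIndex V) = ∑ ρ, Module.finrank ℂ (V ρ) ^ 2 := by
  simp [pow_two]

theorem hyperdet_algebraHypermatrix {E} (hE : ∀ ρ, IsMatrixUnits (E ρ))
    (e : UnitIndex V ≃ Fin n) {d : ℕ} (hd : Even d) (hd0 : 0 < d) :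
    hyperdet d (algebraHypermatrix a d) = C (algebraConstant a Φ E e d) *
      ∏ ρ, (wedderburnCoord a Φ E ρ).det ^ Module.finrank ℂ (V ρ) := by
  obtain ⟨c, rfl⟩ : ∃ c, d = 2 * c + 1 + 1 := by
    obtain ⟨k, hk⟩ := hd
    exact ⟨k - 1, by omega⟩
  change ((n.factorial : ℂ)⁻¹) • hyperSum _ _ = _
  rw [hyperSum_algebraHypermatrix a Φ E e, hyperSum_eq_factorial_mul hd, reducedHyperSum_sigma]
  · rw [Finset.prod_congr rfl fun ρ _ => reducedHyperSum_block a Φ hE c ρ,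
      Fintype.card_congr e, Fintype.card_fin, Finset.prod_mul_distrib, smul_eq_C_mul,
      algebraConstant, transposeSign, show (2 * c + 1 + 1) / 2 = c + 1 by omega,
      Nat.add_sub_cancel]
    have hf : (C ((n.factorial : ℂ)⁻¹) : MvPolynomial (Fin n) ℂ) * (n.factorial : ℕ) = 1 := by
      rw [← map_natCast (C : ℂ →+* MvPolynomial (Fin n) ℂ), ← map_mul,
        inv_mul_cancel₀ (Nat.cast_ne_zero.mpr (Nat.factorial_ne_zero n)), map_one]
    have hs : ∏ ρ, C (((-1) ^ (Module.finrank ℂ (V ρ)).choose 2) ^ (c + 1) *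
        hookProduct (Module.finrank ℂ (V ρ)) ^ c) =
        (C ((-1) ^ ((c + 1) * ∑ ρ, (Module.finrank ℂ (V ρ)).choose 2) *
          (∏ ρ, hookProduct (Module.finrank ℂ (V ρ))) ^ c) : MvPolynomial (Fin n) ℂ) := by
      rw [← map_prod, Finset.prod_mul_distrib, Finset.prod_pow, Finset.prod_pow,
        Finset.prod_pow_eq_pow_sum, ← pow_mul, mul_comm (c + 1)]
    rw [hs]
    simp only [map_mul, map_pow]
    linear_combination (C (wedderburnDet a Φ E e) ^ (2 * c + 1 + 1) *
      (C (-1) ^ ((c + 1) * ∑ ρ, (Module.finrank ℂ (V ρ)).choose 2) *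
          C (∏ ρ, hookProduct (Module.finrank ℂ (V ρ))) ^ c) *
      ∏ ρ, (wedderburnCoord a Φ E ρ).det ^ Module.finrank ℂ (V ρ)) * hf
  · intro J hJ
    rw [prod_pulledUnit_eq_zero Φ E J hJ]
    exact (genericFormLinear a).map_zero

omit [DecidableEq ι] in
theorem wedderburnDet_ne_zero (e : UnitIndex V ≃ Fin n) : wedderburnDet a Φ E e ≠ 0 := by
  have h := LinearEquiv.isUnit_det Φ.toLinearEquiv a ((Pi.basis E).reindex e)
  have : LinearMap.toMatrix a ((Pi.basis E).reindex e) Φ.toLinearEquiv.toLinearMap =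
      (wedderburnMatrix a Φ E).submatrix e.symm id := by
    ext i j
    simp [wedderburnMatrix, LinearMap.toMatrix_apply]
  rw [this] at h
  exact h.ne_zero

omit [DecidableEq ι] in
theorem algebraConstant_ne_zero (e : UnitIndex V ≃ Fin n) (d : ℕ) :
    algebraConstant a Φ E e d ≠ 0 :=
  mul_ne_zero (mul_ne_zero (pow_ne_zero _ (by norm_num))
    (pow_ne_zero _ (wedderburnDet_ne_zero a Φ E e)))
    (pow_ne_zero _ (Finset.prod_ne_zero_iff.mpr fun _ _ => hookProduct_ne_zero _))

omit [DecidableEq ι] in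
theorem normalizedWedderburnDet_eq (e : UnitIndex V ≃ Fin n) :
    normalizedWedderburnDet a Φ E e = (∏ p : UnitIndex V,
      ((Real.sqrt ((Module.finrank ℂ (V p.1) : ℝ) / (n : ℝ)) : ℝ) : ℂ)) *
        wedderburnDet a Φ E e := by
  rw [← e.symm.prod_comp, wedderburnDet, ← Matrix.det_mul_column]
  rfl

omit [DecidableEq ι] in
theorem prod_sqrt_sq :
    (∏ p : UnitIndex V, ((Real.sqrt ((Module.finrank ℂ (V p.1) : ℝ) / (n : ℝ)) : ℝ) : ℂ)) ^ 2 =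
      ∏ ρ, ((Module.finrank ℂ (V ρ) : ℂ) / n) ^ Module.finrank ℂ (V ρ) ^ 2 := by
  rw [← Finset.prod_pow, Fintype.prod_sigma]
  refine Finset.prod_congr rfl fun ρ _ => ?_
  have h : ((Real.sqrt ((Module.finrank ℂ (V ρ) : ℝ) / (n : ℝ)) : ℝ) : ℂ) ^ 2 =
      (Module.finrank ℂ (V ρ) : ℂ) / n := by
    rw [← Complex.ofReal_pow, Real.sq_sqrt (by positivity)]
    push_cast
    rfl
  rw [Finset.prod_congr rfl fun _ _ => h, Finset.prod_const, Finset.card_univ, Fintype.card_prod,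
    Fintype.card_fin, pow_two]

omit [DecidableEq ι] in
-- Let `Q = ∏ (n_ρ / n) ^ n_ρ²`. Normalization multiplies `det Φ ^ d` by `Q ^ (d / 2)` and the
-- bracket by `Q⁻¹`, hence its power by `Q ^ (-(d / 2 - 1))`. One factor `Q` remains, and the
-- rescaling of the coordinates contributes `Q⁻¹`.
theorem normalizedAlgebraConstant_mul (e : UnitIndex V ≃ Fin n) {d : ℕ} (hd : Even d)
    (hd0 : 0 < d) :
    normalizedAlgebraConstant a Φ E e d *
      (∏ ρ, ((n : ℂ) / (Module.finrank ℂ (V ρ) : ℂ)) ^ Module.finrank ℂ (V ρ) ^ 2) =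
        algebraConstant a Φ E e d := by
  obtain ⟨c, rfl⟩ : ∃ c, d = 2 * (c + 1) := by
    obtain ⟨k, hk⟩ := hd
    exact ⟨k - 1, by omega⟩
  set Q := ∏ ρ, ((Module.finrank ℂ (V ρ) : ℂ) / n) ^ Module.finrank ℂ (V ρ) ^ 2 with hQ
  have hcard : n = ∑ ρ, Module.finrank ℂ (V ρ) ^ 2 := by
    rw [← card_unitIndex, Fintype.card_congr e, Fintype.card_fin]
  have hn : ∀ ρ, Module.finrank ℂ (V ρ) ≠ 0 → n ≠ 0 := fun ρ h h0 => by
    have := Finset.sum_eq_zero_iff.mp (hcard.symm.trans h0) ρ (Finset.mem_univ ρ)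
    exact h (by simpa using this)
  have hpow : ∀ ρ, ((Module.finrank ℂ (V ρ) : ℂ) / n) ^ Module.finrank ℂ (V ρ) ^ 2 ≠ 0 := by
    intro ρ
    -- Zero spaces are not excluded here; for them the exponent vanishes and the factor is `1`.
    rcases eq_or_ne (Module.finrank ℂ (V ρ)) 0 with h | h
    · rw [h]; simp
    · exact pow_ne_zero _ (div_ne_zero (Nat.cast_ne_zero.mpr h) (Nat.cast_ne_zero.mpr (hn ρ h)))
  have hQ0 : Q ≠ 0 := Finset.prod_ne_zero_iff.mpr fun ρ _ => hpow ρ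
  have hinv : (∏ ρ, ((n : ℂ) / (Module.finrank ℂ (V ρ) : ℂ)) ^ Module.finrank ℂ (V ρ) ^ 2) =
      Q⁻¹ := by
    rw [hQ, ← Finset.prod_inv_distrib]
    refine Finset.prod_congr rfl fun ρ _ => ?_
    rw [← inv_pow, inv_div]
  have hnn : (n : ℂ) ^ n = ∏ ρ, (n : ℂ) ^ Module.finrank ℂ (V ρ) ^ 2 := by
    rw [Finset.prod_pow_eq_pow_sum, ← hcard]
  have hH : (n : ℂ) ^ n * ∏ ρ, hookProduct (Module.finrank ℂ (V ρ)) /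
      (Module.finrank ℂ (V ρ) : ℂ) ^ (Module.finrank ℂ (V ρ) ^ 2) =
      (∏ ρ, hookProduct (Module.finrank ℂ (V ρ))) * Q⁻¹ := by
    rw [← hinv, hnn, ← Finset.prod_mul_distrib, ← Finset.prod_mul_distrib]
    refine Finset.prod_congr rfl fun ρ _ => ?_
    rw [div_pow]
    ring
  rw [normalizedAlgebraConstant, algebraConstant, hinv, hH, normalizedWedderburnDet_eq, mul_pow,
    pow_mul (∏ p : UnitIndex V, _), prod_sqrt_sq, ← hQ,
    show 2 * (c + 1) / 2 = c + 1 by omega, Nat.add_sub_cancel, mul_pow, pow_succ Q, inv_pow]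
  field_simp

omit [DecidableEq ι] in
theorem normalizedAlgebraConstant_ne_zero (e : UnitIndex V ≃ Fin n) {d : ℕ} (hd : Even d)
    (hd0 : 0 < d) : normalizedAlgebraConstant a Φ E e d ≠ 0 := fun h =>
  algebraConstant_ne_zero a Φ E e d (by
    rw [← normalizedAlgebraConstant_mul a Φ E e hd hd0, h, zero_mul])

theorem prod_det_normalizedWedderburnCoord :
    ∏ ρ, (normalizedWedderburnCoord a Φ E ρ).det ^ Module.finrank ℂ (V ρ) =
      C (∏ ρ, ((n : ℂ) / (Module.finrank ℂ (V ρ) : ℂ)) ^ Module.finrank ℂ (V ρ) ^ 2) *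
        ∏ ρ, (wedderburnCoord a Φ E ρ).det ^ Module.finrank ℂ (V ρ) := by
  rw [map_prod, ← Finset.prod_mul_distrib]
  refine Finset.prod_congr rfl fun ρ _ => ?_
  have : normalizedWedderburnCoord a Φ E ρ =
      (C ((n : ℂ) / (Module.finrank ℂ (V ρ) : ℂ)) : MvPolynomial (Fin n) ℂ) •
        wedderburnCoord a Φ E ρ := by
    refine Matrix.ext fun i j => ?_
    simp [normalizedWedderburnCoord, smul_eq_C_mul]
  rw [this, Matrix.det_smul, Fintype.card_fin, mul_pow, ← pow_mul, ← pow_two, map_pow]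

omit [Fintype ι] in
theorem det_wedderburnCoord_eq {E E'} (hE : ∀ ρ, IsMatrixUnits (E ρ))
    (hE' : ∀ ρ, IsMatrixUnits (E' ρ)) (ρ : ι) :
    (wedderburnCoord a Φ E ρ).det = (wedderburnCoord a Φ E' ρ).det :=
  det_apply_matrixUnits_eq (hE ρ) (hE' ρ) (genericFormLinear a ∘ₗ Φ.symm.toLinearMap ∘ₗ
    LinearMap.single ℂ (fun ρ => Module.End ℂ (V ρ)) ρ)

omit [DecidableEq ι] in
include a Φ in
theorem sum_finrank_sq_eq [∀ ρ, Module.Finite ℂ (V ρ)] :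
    ∑ ρ, Module.finrank ℂ (V ρ) ^ 2 = n := by
  have h := Φ.toLinearEquiv.finrank_eq
  rw [Module.finrank_eq_card_basis a, Fintype.card_fin, Module.finrank_pi_fintype] at h
  rw [h]
  exact Finset.sum_congr rfl fun ρ _ => by rw [Module.finrank_linearMap, pow_two]

end AlgebraHypermatrix

end

theorem theorem1p4 {A : Type u} [Ring A] [Algebra ℂ A] [IsSemisimpleRing A]
    {n : ℕ} (a : Module.Basis (Fin n) ℂ A)
    {ι : Type w} [Fintype ι] [DecidableEq ι] (V : ι → Type v)
    [∀ ρ, AddCommGroup (V ρ)] [∀ ρ, Module ℂ (V ρ)] [∀ ρ, Module A (V ρ)]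
    [∀ ρ, IsScalarTower ℂ A (V ρ)]
    (hV : IsCompleteSetOfSimples A V)
    (d : ℕ) (hd : Even d) (hd0 : 0 < d) :
    ∃ hΦ : Function.Bijective (wedderburnHom A V),
      (∑ ρ, Module.finrank ℂ (V ρ) ^ 2 = n) ∧
      (∀ E : ∀ ρ, Module.Basis
            (Fin (Module.finrank ℂ (V ρ)) × Fin (Module.finrank ℂ (V ρ))) ℂ
            (Module.End ℂ (V ρ)),
        (∀ ρ, IsMatrixUnits (E ρ)) → ∀ e : UnitIndex V ≃ Fin n,
          (hyperdet d (algebraHypermatrix a d) =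
            MvPolynomial.C (algebraConstant a (wedderburnEquiv A V hΦ) E e d) *
              ∏ ρ, (wedderburnCoord a (wedderburnEquiv A V hΦ) E ρ).det ^ Module.finrank ℂ (V ρ)) ∧
          algebraConstant a (wedderburnEquiv A V hΦ) E e d ≠ 0 ∧
          (hyperdet d (algebraHypermatrix a d) =
            MvPolynomial.C (normalizedAlgebraConstant a (wedderburnEquiv A V hΦ) E e d) *
              ∏ ρ, (normalizedWedderburnCoord a (wedderburnEquiv A V hΦ) E ρ).det ^ Module.finrank ℂ (V ρ)) ∧
          normalizedAlgebraConstant a (wedderburnEquiv A V hΦ) E e d ≠ 0) ∧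
      (∀ E E' : ∀ ρ, Module.Basis
            (Fin (Module.finrank ℂ (V ρ)) × Fin (Module.finrank ℂ (V ρ))) ℂ
            (Module.End ℂ (V ρ)),
        (∀ ρ, IsMatrixUnits (E ρ)) → (∀ ρ, IsMatrixUnits (E' ρ)) →
          ∀ ρ, (wedderburnCoord a (wedderburnEquiv A V hΦ) E ρ).det = (wedderburnCoord a (wedderburnEquiv A V hΦ) E' ρ).det) := by
  have hfin : Module.Finite ℂ A := Module.Finite.of_basis a
  have hsimple := hV.simple
  have hfinV := fun ρ => finiteDimensional_of_isSimpleModule (A := A) (V ρ)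
  refine ⟨⟨wedderburnHom_injective hV, wedderburnHom_surjective hV⟩, ?_, ?_, ?_⟩
  · exact sum_finrank_sq_eq a
      (wedderburnEquiv A V ⟨wedderburnHom_injective hV, wedderburnHom_surjective hV⟩)
  · intro E hE e
    have h := hyperdet_algebraHypermatrix a
      (wedderburnEquiv A V ⟨wedderburnHom_injective hV, wedderburnHom_surjective hV⟩) hE e hd hd0
    refine ⟨h, algebraConstant_ne_zero _ _ _ _ _, ?_,
      normalizedAlgebraConstant_ne_zero _ _ _ _ hd hd0⟩
    rw [h, prod_det_normalizedWedderburnCoord, ← mul_assoc, ← map_mul,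
      normalizedAlgebraConstant_mul _ _ _ _ hd hd0]
  · intro E E' hE hE' ρ
    exact det_wedderburnCoord_eq a _ hE hE' ρ
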